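/- A (directed) graph $E=(E^0,E^1,\mathbf s,\mathbf r)$ has arbitrary sets $E^0$ of vertices and $E^1$ of edges and source and range maps $\mathbf s,\mathbf r:E^1\to E^0$. A vertex is an infinite emitter if it emits infinitely many edges, and it is regular if it emits at least one and only finitely many edges. A path $p$ is a vertex (of length $|p|=0$, with source and range itself) or a sequence of edges $e_1\cdots e_n$, $n\ge 1$, with $\mathbf r(e_i)=\mathbf s(e_{i+1})$ (of length $|p|=n$, with source $\mathbf s(e_1)$ and range $\mathbf r(e_n)$). Let $K$ be any field with an involution $k\mapsto k^*$ (a field automorphism whose square is the identity, possibly the identity itself). The Leavitt path algebra $L_K(E)$ is the associative, not necessarily unital, $K$-algebra freely generated by $E^0\cup E^1\cup\{e^*\mid e\in E^1\}$ subject to the relations, for all vertices $v,w$ and edges $e,f$: $vv=v$ and $vw=0$ if $v\ne w$; $\mathbf s(e)e=e\mathbf r(e)=e$; $\mathbf r(e)e^*=e^*\mathbf s(e)=e^*$; $e^*e=\mathbf r(e)$ and $e^*f=0$ if $e\neq f$; $v=\sum_{e\in\mathbf s^{-1}(v)}ee^*$ for each regular vertex $v$. Put $v^*=v$ for a vertex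 $v$ and $p^*=e_n^*\cdots e_1^*$ for a path $p=e_1\cdots e_n$. The algebra $L_K(E)$ is $\mathbb Z$-graded, with $L_K(E)_n$ the $K$-span of the elements $pq^*$ for paths $p,q$ with $|p|-|q|=n$, and it is a $*$-algebra with $\left(\sum_i k_ip_iq_i^*\right)^*=\sum_i k_i^*q_ip_i^*$. A set $H\subseteq E^0$ is hereditary if $\mathbf r(p)\in H$ for every path $p$ with $\mathbf s(p)\in H$, and saturated if $v\in H$ for every regular vertex $v$ with $\mathbf r(\mathbf s^{-1}(v))\subseteq H$. For $H$ hereditary and saturated, let $B_H$ be the set of infinite emitters $v\notin H$ such that $\mathbf s^{-1}(v)\cap\mathbf r^{-1}(E^0-H)$ is nonempty and finite, and for $v\in B_H$ put $v^H=v-\sum_{e\in\mathbf s^{-1}(v)\cap\mathbf r^{-1}(E^0-H)}ee^*$. An admissible pair of $E$ is a pair $(H,S)$ where $H\subseteq E^0$ is hereditary and saturated and $S\subseteq B_H$. Let $I(H,S)$ be the (graded) two-sided ideal of $L_K(E)$ generated by $H\cup\{v^H\mid v\in S\}$. Let $F_1$ be the set of paths $e_1\cdots e_n$, $n\ge1$,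 with $\mathbf r(e_n)\in H$ and $\mathbf s(e_n)\notin H\cup S$, and let $F_2$ be the set of paths $p$ with $|p|>0$ and $\mathbf r(p)\in S$. The porcupine graph $P_{(H,S)}$ has the vertices $$H\cup S\cup\{w^p\mid p\in F_1\cup F_2\}$$ and the edges $$\{e\in E^1\mid\mathbf s(e)\in H\}\cup\{e\in E^1\mid \mathbf s(e)\in S,\ \mathbf r(e)\in H\}\cup\{f^p\mid p\in F_1\cup F_2\},$$ where the $w^p$ and the $f^p$ are new and distinct for distinct $p$. The source and range of an edge $e\in E^1$ are the same as in $E$; $\mathbf s(f^p)=w^p$ for all $p\in F_1\cup F_2$; $\mathbf r(f^e)=\mathbf r(e)$ if $p=e$ is a single edge; and $\mathbf r(f^p)=w^q$ if $p=eq$ with $e\in E^1$ and $|q|\ge1$ (then $q\in F_1\cup F_2$). **Theorem.** For every admissible pair $(H,S)$ of a graph $E$, the ideal $I(H,S)$ of $L_K(E)$ and the Leavitt path algebra $L_K(P_{(H,S)})$ are graded $*$-isomorphic, that is, there is a $K$-algebra isomorphism between them which preserves the involution and the $\mathbb Z$-grading. Consequently, every graded two-sided ideal of $L_K(E)$ is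 graded $*$-isomorphic to $L_K(F)$ for some graph $F$. -/

import Mathlib

universe u v w

noncomputable section

/-- A directed graph: vertices `Vert`, edges `Edge`, source and range maps.  No finiteness or
countability is assumed; loops and parallel edges are allowed. -/
structure DirGraph where
  /-- the set of vertices -/
  Vert : Type u
  /-- the set of edges -/
  Edge : Type v
  /-- the source of an edge -/
  src : Edge → Vert
  /-- the range of an edge -/
  rng : Edge → Vert

namespace DirGraph

variable (E : DirGraph.{u, v})

/-- The set of edges emitted by a vertex. -/
def emitted (x : E.Vert) : Set E.Edge := {e | E.src e = x}

/-- A sink emits no edges. -/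
def IsSink (x : E.Vert) : Prop := E.emitted x = ∅

/-- An infinite emitter emits infinitely many edges. -/
def IsInfiniteEmitter (x : E.Vert) : Prop := (E.emitted x).Infinite

/-- A regular vertex is neither a sink nor an infinite emitter. -/
def IsRegular (x : E.Vert) : Prop := ¬ E.IsSink x ∧ ¬ E.IsInfiniteEmitter x

variable {E} in
/-- The edges emitted by a regular vertex, as a `Finset`. -/
def IsRegular.out {x : E.Vert} (hx : E.IsRegular x) : Finset E.Edge :=
  (Set.not_infinite.mp hx.2 : (E.emitted x).Finite).toFinset

/-- A path: a single vertex, or a nonempty composable sequence of edges `e :: l`. -/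
inductive Path : Type (max u v)
  | vert (x : E.Vert) : Path
  | edges (e : E.Edge) (l : List E.Edge)
      (h : (e :: l).IsChain (fun a b => E.rng a = E.src b)) : Path

namespace Path

variable {E}

/-- The length of a path. -/
def length : E.Path → ℕ
  | vert _ => 0
  | edges _ l _ => l.length + 1

/-- The source of a path. -/
def src : E.Path → E.Vert
  | vert x => x
  | edges e _ _ => E.src e

/-- The range of a path. -/
def rng : E.Path → E.Vert
  | vert x => x
  | edges e l _ => E.rng ((e :: l).getLast (List.cons_ne_nil e l))

end Path

/-! ### The Leavitt path algebra -/

/-- The generators of the Leavitt path algebra: vertices, edges `e` and ghost edges `e*`. -/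
inductive Gen : Type (max u v)
  | vert (x : E.Vert) : Gen
  | edge (e : E.Edge) : Gen
  | ghost (e : E.Edge) : Gen

/-- The involution on the generators: `v* = v`, `e ↦ e*`, `e* ↦ e`. -/
def Gen.inv {E : DirGraph.{u, v}} : E.Gen → E.Gen
  | .vert x => .vert x
  | .edge e => .ghost e
  | .ghost e => .edge e

lemma Gen.inv_inv {E : DirGraph.{u, v}} (g : E.Gen) : g.inv.inv = g := by
  cases g <;> rfl

end DirGraph

section LPA

variable (K : Type w) [Field K] (E : DirGraph.{u, v})

/-- The free (associative, not necessarily unital) `K`-algebra on the generators: the semigroup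
algebra of the free semigroup. -/
abbrev FreeLPA : Type (max u v w) := MonoidAlgebra K (FreeSemigroup E.Gen)

namespace FreeLPA

/-- A vertex as an element of the free algebra. -/
def vert (x : E.Vert) : FreeLPA K E := MonoidAlgebra.single (FreeSemigroup.of (.vert x)) 1

/-- An edge as an element of the free algebra. -/
def edge (e : E.Edge) : FreeLPA K E := MonoidAlgebra.single (FreeSemigroup.of (.edge e)) 1

/-- A ghost edge as an element of the free algebra. -/
def ghost (e : E.Edge) : FreeLPA K E := MonoidAlgebra.single (FreeSemigroup.of (.ghost e)) 1

/-- The defining relations (V), (E1), (E2), (CK1), (CK2). -/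
inductive Rel : FreeLPA K E → FreeLPA K E → Prop
  | vert_mul_of_ne (x y : E.Vert) (h : x ≠ y) : Rel (vert K E x * vert K E y) 0
  | vert_mul_self (x : E.Vert) : Rel (vert K E x * vert K E x) (vert K E x)
  | src_mul_edge (e : E.Edge) : Rel (vert K E (E.src e) * edge K E e) (edge K E e)
  | edge_mul_rng (e : E.Edge) : Rel (edge K E e * vert K E (E.rng e)) (edge K E e)
  | rng_mul_ghost (e : E.Edge) : Rel (vert K E (E.rng e) * ghost K E e) (ghost K E e)
  | ghost_mul_src (e : E.Edge) : Rel (ghost K E e * vert K E (E.src e)) (ghost K E e)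
  | ghost_mul_edge_of_ne (e f : E.Edge) (h : e ≠ f) : Rel (ghost K E e * edge K E f) 0
  | ghost_mul_edge (e : E.Edge) : Rel (ghost K E e * edge K E e) (vert K E (E.rng e))
  | ck2 (x : E.Vert) (hx : E.IsRegular x) :
      Rel (vert K E x) (∑ e ∈ hx.out, edge K E e * ghost K E e)

/-- The `K`-algebra congruence generated by the defining relations: the ring congruence generated
by all their scalar multiples. -/
def con : RingCon (FreeLPA K E) :=
  ringConGen fun a b => ∃ (k : K) (x y : FreeLPA K E), Rel K E x y ∧ a = k • x ∧ b = k • y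

lemma con_smul (k : K) {a b : FreeLPA K E} (h : con K E a b) : con K E (k • a) (k • b) := by
  change RingConGen.Rel _ _ _ at h
  induction h with
  | of x y h =>
    obtain ⟨c, x', y', hr, rfl, rfl⟩ := h
    exact .of _ _ ⟨k * c, x', y', hr, by rw [mul_smul], by rw [mul_smul]⟩
  | refl x => exact .refl _
  | symm _ ih => exact .symm ih
  | trans _ _ ih₁ ih₂ => exact .trans ih₁ ih₂
  | add _ _ ih₁ ih₂ => rw [smul_add, smul_add]; exact .add ih₁ ih₂
  | mul _ h₂ ih₁ _ => rw [← smul_mul_assoc, ← smul_mul_assoc]; exact .mul ih₁ h₂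

end FreeLPA

/-- The Leavitt path algebra `L_K(E)`, an associative `K`-algebra (in general without unit). -/
def LPA : Type (max u v w) := (FreeLPA.con K E).Quotient

namespace LPA

instance : NonUnitalRing (LPA K E) := inferInstanceAs (NonUnitalRing (FreeLPA.con K E).Quotient)

/-- The quotient map from the free algebra. -/
def mk : FreeLPA K E →+ LPA K E where
  toFun x := ((x : FreeLPA K E) : (FreeLPA.con K E).Quotient)
  map_zero' := rfl
  map_add' _ _ := rfl

lemma mk_surjective : Function.Surjective (mk K E) := fun x => Quotient.inductionOn' x
  fun a => ⟨a, rfl⟩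

lemma mk_mul (x y : FreeLPA K E) : mk K E (x * y) = mk K E x * mk K E y := rfl

lemma mk_eq_iff (x y : FreeLPA K E) : mk K E x = mk K E y ↔ FreeLPA.con K E x y :=
  RingCon.eq _

instance : SMul K (LPA K E) where
  smul k := Quotient.map' (fun x => k • x) fun _ _ h => FreeLPA.con_smul K E k h

lemma mk_smul (k : K) (x : FreeLPA K E) : mk K E (k • x) = k • mk K E x := rfl

instance : Module K (LPA K E) := (mk_surjective K E).module K (mk K E) (mk_smul K E)

instance : IsScalarTower K (LPA K E) (LPA K E) where
  smul_assoc k x y := by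
    obtain ⟨x, rfl⟩ := mk_surjective K E x
    obtain ⟨y, rfl⟩ := mk_surjective K E y
    simp only [smul_eq_mul, ← mk_smul, ← mk_mul, smul_mul_assoc]

instance : SMulCommClass K (LPA K E) (LPA K E) where
  smul_comm k x y := by
    obtain ⟨x, rfl⟩ := mk_surjective K E x
    obtain ⟨y, rfl⟩ := mk_surjective K E y
    simp only [smul_eq_mul, ← mk_smul, ← mk_mul, mul_smul_comm]

/-- A vertex as an element of `L_K(E)`. -/
def vert (x : E.Vert) : LPA K E := mk K E (FreeLPA.vert K E x)

/-- An edge as an element of `L_K(E)`. -/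
def edge (e : E.Edge) : LPA K E := mk K E (FreeLPA.edge K E e)

/-- A ghost edge `e*` as an element of `L_K(E)`. -/
def ghost (e : E.Edge) : LPA K E := mk K E (FreeLPA.ghost K E e)

/-- The product `e₁ e₂ ⋯ eₙ` of a nonempty sequence of edges. -/
def edgesElt (e : E.Edge) : List E.Edge → LPA K E
  | [] => edge K E e
  | f :: l => edge K E e * edgesElt f l

/-- The product `eₙ* ⋯ e₂* e₁*` for a nonempty sequence of edges. -/
def ghostsElt (e : E.Edge) : List E.Edge → LPA K E
  | [] => ghost K E e
  | f :: l => ghostsElt f l * ghost K E e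

/-- A path `p` as an element of `L_K(E)`. -/
def pathElt : E.Path → LPA K E
  | .vert x => vert K E x
  | .edges e l _ => edgesElt K E e l

/-- The element `p*` of `L_K(E)` for a path `p`. -/
def ghostElt : E.Path → LPA K E
  | .vert x => vert K E x
  | .edges e l _ => ghostsElt K E e l

/-- The homogeneous component `L_K(E)_n`: the `K`-span of the elements `p q*` with
`|p| - |q| = n`. -/
def component (n : ℤ) : Submodule K (LPA K E) :=
  Submodule.span K {x | ∃ p q : E.Path, (p.length : ℤ) - q.length = n ∧
    x = pathElt K E p * ghostElt K E q}

/-- A two-sided ideal `I` is graded if it is the sum of the `I ∩ L_K(E)_n`, that is, if every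
element of `I` is a sum of homogeneous elements of `I`. -/
def IsGradedIdeal (I : TwoSidedIdeal (LPA K E)) : Prop :=
  ∀ x ∈ I, x ∈ AddSubgroup.closure {y : LPA K E | y ∈ I ∧ ∃ n : ℤ, y ∈ component K E n}

end LPA

end LPA

/-! ### The involution of the Leavitt path algebra -/

section Involution

variable (K : Type w) [Field K] [StarRing K] (E : DirGraph.{u, v})

namespace FreeLPA

/-- The involution on words: reverse the word and apply the involution to each letter. -/
def wordInv : FreeSemigroup E.Gen →ₙ* (FreeSemigroup E.Gen)ᵐᵒᵖ :=
  FreeSemigroup.lift fun g => MulOpposite.op (FreeSemigroup.of g.inv)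

lemma wordInv_wordInv (s : FreeSemigroup E.Gen) :
    (wordInv E (wordInv E s).unop).unop = s := by
  induction s using FreeSemigroup.recOnMul with
  | ih1 g => simp [wordInv, DirGraph.Gen.inv_inv]
  | ih2 x y hx hy => rw [map_mul, MulOpposite.unop_mul, map_mul, MulOpposite.unop_mul, hx, hy]

/-- The conjugate-linear involution `∑ kᵢ sᵢ ↦ ∑ kᵢ* sᵢ*` of the free algebra. -/
def inv : FreeLPA K E →+ FreeLPA K E :=
  (Finsupp.liftAddHom fun s => (MonoidAlgebra.singleAddHom (wordInv E s).unop).comp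
    (starAddEquiv : K ≃+ K).toAddMonoidHom).comp MonoidAlgebra.coeffAddEquiv.toAddMonoidHom

lemma inv_single (s : FreeSemigroup E.Gen) (k : K) :
    inv K E (MonoidAlgebra.single s k) = MonoidAlgebra.single (wordInv E s).unop (star k) := by
  simp [inv]

lemma inv_inv (x : FreeLPA K E) : inv K E (inv K E x) = x := by
  induction x using MonoidAlgebra.induction_linear with
  | zero => simp
  | add x y hx hy => rw [map_add, map_add, hx, hy]
  | single s k => rw [inv_single, inv_single, wordInv_wordInv, star_star]

lemma inv_mul (x y : FreeLPA K E) : inv K E (x * y) = inv K E y * inv K E x := by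
  induction x using MonoidAlgebra.induction_linear with
  | zero => simp
  | add x x' hx hx' => rw [add_mul, map_add, map_add, hx, hx', mul_add]
  | single s k =>
    induction y using MonoidAlgebra.induction_linear with
    | zero => simp
    | add y y' hy hy' => rw [mul_add, map_add, map_add, hy, hy', add_mul]
    | single t l =>
      rw [MonoidAlgebra.single_mul_single, inv_single, inv_single, inv_single,
        MonoidAlgebra.single_mul_single, map_mul, MulOpposite.unop_mul, star_mul]

lemma inv_smul (k : K) (x : FreeLPA K E) : inv K E (k • x) = star k • inv K E x := by
  induction x using MonoidAlgebra.induction_linear with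
  | zero => simp
  | add x y hx hy => rw [smul_add, map_add, map_add, hx, hy, smul_add]
  | single s l =>
    rw [MonoidAlgebra.smul_single, inv_single, inv_single, MonoidAlgebra.smul_single, smul_eq_mul,
      smul_eq_mul, star_mul']

lemma inv_vert (x : E.Vert) : inv K E (vert K E x) = vert K E x := by
  rw [vert, inv_single, star_one]; rfl

lemma inv_edge (e : E.Edge) : inv K E (edge K E e) = ghost K E e := by
  rw [edge, inv_single, star_one]; rfl

lemma inv_ghost (e : E.Edge) : inv K E (ghost K E e) = edge K E e := by
  rw [ghost, inv_single, star_one]; rfl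

lemma inv_rel {x y : FreeLPA K E} (h : Rel K E x y) : Rel K E (inv K E x) (inv K E y) := by
  induction h with
  | vert_mul_of_ne x y h => simpa only [inv_mul, inv_vert, map_zero] using .vert_mul_of_ne _ _ h.symm
  | vert_mul_self x => simpa only [inv_mul, inv_vert] using .vert_mul_self x
  | src_mul_edge e => simpa only [inv_mul, inv_vert, inv_edge] using .ghost_mul_src e
  | edge_mul_rng e => simpa only [inv_mul, inv_vert, inv_edge] using .rng_mul_ghost e
  | rng_mul_ghost e => simpa only [inv_mul, inv_vert, inv_ghost] using .edge_mul_rng e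
  | ghost_mul_src e => simpa only [inv_mul, inv_vert, inv_ghost] using .src_mul_edge e
  | ghost_mul_edge_of_ne e f h =>
    simpa only [inv_mul, inv_edge, inv_ghost, map_zero] using .ghost_mul_edge_of_ne _ _ h.symm
  | ghost_mul_edge e =>
    simpa only [inv_mul, inv_edge, inv_ghost, inv_vert] using .ghost_mul_edge e
  | ck2 x hx =>
    simpa only [map_sum, inv_mul, inv_edge, inv_ghost, inv_vert] using .ck2 x hx

lemma con_inv {x y : FreeLPA K E} (h : con K E x y) : con K E (inv K E x) (inv K E y) := by
  change RingConGen.Rel _ _ _ at h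
  induction h with
  | of x y h =>
    obtain ⟨c, x', y', hr, rfl, rfl⟩ := h
    exact .of _ _ ⟨star c, _, _, inv_rel K E hr, inv_smul K E c x', inv_smul K E c y'⟩
  | refl x => exact .refl _
  | symm _ ih => exact .symm ih
  | trans _ _ ih₁ ih₂ => exact .trans ih₁ ih₂
  | add _ _ ih₁ ih₂ => rw [map_add (inv K E), map_add (inv K E)]; exact .add ih₁ ih₂
  | mul _ _ ih₁ ih₂ => rw [inv_mul, inv_mul]; exact .mul ih₂ ih₁

end FreeLPA

namespace LPA

instance : Star (LPA K E) where
  star := Quotient.map' (FreeLPA.inv K E) fun _ _ h => FreeLPA.con_inv K E h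

lemma star_mk (x : FreeLPA K E) : star (mk K E x) = mk K E (FreeLPA.inv K E x) := rfl

/-- The involution of `L_K(E)` determined by the involution of `K`: it fixes the vertices and
exchanges `e` and `e*`. -/
instance : StarRing (LPA K E) where
  star_involutive x := by
    obtain ⟨x, rfl⟩ := mk_surjective K E x
    rw [star_mk, star_mk, FreeLPA.inv_inv]
  star_mul x y := by
    obtain ⟨x, rfl⟩ := mk_surjective K E x
    obtain ⟨y, rfl⟩ := mk_surjective K E y
    rw [← mk_mul, star_mk, star_mk, star_mk, ← mk_mul, FreeLPA.inv_mul]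
  star_add x y := by
    obtain ⟨x, rfl⟩ := mk_surjective K E x
    obtain ⟨y, rfl⟩ := mk_surjective K E y
    rw [← map_add, star_mk, star_mk, star_mk, ← map_add, map_add (FreeLPA.inv K E)]

instance : StarModule K (LPA K E) where
  star_smul k x := by
    obtain ⟨x, rfl⟩ := mk_surjective K E x
    rw [← mk_smul, star_mk, star_mk, ← mk_smul, FreeLPA.inv_smul]

/-- `L_K(F)` and the ideal `I` of `L_K(E)` are graded `*`-isomorphic: there is a `K`-algebra
`*`-homomorphism `φ` from `L_K(F)` to `L_K(E)` that maps `L_K(F)` bijectively onto `I` and under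
which `L_K(F)_n` corresponds to `I ∩ L_K(E)_n` for every `n`.  (In particular `I` is then closed
under the scalars and the involution.) -/
def IsGradedStarIsoIdeal (F : DirGraph) (I : TwoSidedIdeal (LPA K E)) : Prop :=
  ∃ φ : LPA K F →⋆ₙₐ[K] LPA K E,
    Function.Injective φ ∧ Set.range φ = (I : Set (LPA K E)) ∧
      ∀ (n : ℤ) (x : LPA K F), x ∈ component K F n ↔ φ x ∈ component K E n

end LPA

end Involution

/-! ### Admissible pairs, the ideal `I(H,S)` and the porcupine graph -/

namespace DirGraph

variable (E : DirGraph.{u, v})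

/-- `H` is hereditary if every path starting in `H` ends in `H`. -/
def IsHereditary (H : Set E.Vert) : Prop := ∀ p : E.Path, p.src ∈ H → p.rng ∈ H

/-- `H` is saturated if it contains each regular vertex all of whose edges end in `H`. -/
def IsSaturated (H : Set E.Vert) : Prop :=
  ∀ x, E.IsRegular x → E.rng '' E.emitted x ⊆ H → x ∈ H

/-- The edges emitted by `x` whose range is not in `H`. -/
def escaping (H : Set E.Vert) (x : E.Vert) : Set E.Edge := E.emitted x ∩ E.rng ⁻¹' Hᶜ

/-- The set `B_H` of infinite emitters outside `H` which emit a nonzero finite number of edges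
with range outside `H`. -/
def breaking (H : Set E.Vert) : Set E.Vert :=
  {x | x ∉ H ∧ E.IsInfiniteEmitter x ∧ (E.escaping H x).Nonempty ∧ (E.escaping H x).Finite}

/-- An admissible pair `(H, S)`. -/
structure AdmissiblePair where
  /-- the hereditary and saturated set of vertices -/
  H : Set E.Vert
  /-- the set of breaking vertices -/
  S : Set E.Vert
  hereditary : E.IsHereditary H
  saturated : E.IsSaturated H
  subset_breaking : S ⊆ E.breaking H

/-- The element `x^H = x - ∑ e e*`, summed over the (finitely many, if `x ∈ B_H`) edges emitted by
`x` whose range is not in `H`. -/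
def gapElt (K : Type w) [Field K] (H : Set E.Vert) (x : E.Vert) : LPA K E :=
  LPA.vert K E x - ∑ᶠ e ∈ E.escaping H x, LPA.edge K E e * LPA.ghost K E e

namespace AdmissiblePair

variable {E} (P : E.AdmissiblePair)

/-- The ideal `I(H,S)` generated by `H` and the elements `x^H` for `x ∈ S`. -/
def ideal (K : Type w) [Field K] : TwoSidedIdeal (LPA K E) :=
  TwoSidedIdeal.span (LPA.vert K E '' P.H ∪ E.gapElt K P.H '' P.S)

/-- `F₁(H,S)`: the paths `e₁ ⋯ eₙ` with `r(eₙ) ∈ H` and `s(eₙ) ∉ H ∪ S`. -/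
def F₁ : Set E.Path := {p | match p with
  | .vert _ => False
  | .edges e l _ => E.rng ((e :: l).getLast (List.cons_ne_nil e l)) ∈ P.H ∧
      E.src ((e :: l).getLast (List.cons_ne_nil e l)) ∉ P.H ∪ P.S}

/-- `F₂(H,S)`: the paths of positive length with range in `S`. -/
def F₂ : Set E.Path := {p | p.rng ∈ P.S ∧ 0 < p.length}

/-- The vertices of the porcupine graph: the elements of `H ∪ S`, and a new vertex `w^p` for each
`p ∈ F₁ ∪ F₂`. -/
inductive PorcupineVert : Type (max u v)
  | body (x : E.Vert) (h : x ∈ P.H ∪ P.S) : PorcupineVert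
  | spine (p : E.Path) (h : p ∈ P.F₁ ∪ P.F₂) : PorcupineVert

/-- The edges of the porcupine graph: the edges of `E` with source in `H` or with source in `S`
and range in `H`, and a new edge `f^p` for each `p ∈ F₁ ∪ F₂`. -/
inductive PorcupineEdge : Type (max u v)
  | body (e : E.Edge) (h : E.src e ∈ P.H ∨ (E.src e ∈ P.S ∧ E.rng e ∈ P.H)) : PorcupineEdge
  | spine (p : E.Path) (h : p ∈ P.F₁ ∪ P.F₂) : PorcupineEdge

lemma rng_mem_body {e : E.Edge} (h : E.src e ∈ P.H ∨ (E.src e ∈ P.S ∧ E.rng e ∈ P.H)) :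
    E.rng e ∈ P.H ∪ P.S :=
  Or.inl (h.elim (fun h => P.hereditary (.edges e [] (List.isChain_singleton e)) h) fun h => h.2)

lemma rng_mem_of_edge {e : E.Edge} {hc} (h : Path.edges e [] hc ∈ P.F₁ ∪ P.F₂) :
    E.rng e ∈ P.H ∪ P.S :=
  h.imp (fun h => h.1) fun h => h.1

lemma tail_mem {e f : E.Edge} {l : List E.Edge} {hc}
    (h : Path.edges e (f :: l) hc ∈ P.F₁ ∪ P.F₂) : Path.edges f l hc.tail ∈ P.F₁ ∪ P.F₂ :=
  h.imp (fun h => h) fun h => ⟨h.1, Nat.succ_pos _⟩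

/-- The range of the edge `f^p`: it is `r(e)` if `p = e` is an edge, and `w^q` if `p = eq` with
`|q| ≥ 1`. -/
def spineRng : (p : E.Path) → p ∈ P.F₁ ∪ P.F₂ → P.PorcupineVert
  | .vert _, h => (h.elim (fun h => h) fun h => absurd h.2 (lt_irrefl 0)).elim
  | .edges e [] _, h => .body (E.rng e) (P.rng_mem_of_edge h)
  | .edges _ (f :: l) hc, h => .spine (.edges f l hc.tail) (P.tail_mem h)

/-- The porcupine graph `P_(H,S)`. -/
def porcupine : DirGraph.{max u v, max u v} where
  Vert := P.PorcupineVert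
  Edge := P.PorcupineEdge
  src
    | .body e h => .body (E.src e) (h.imp id And.left)
    | .spine p h => .spine p h
  rng
    | .body e h => .body (E.rng e) (P.rng_mem_body h)
    | .spine p h => P.spineRng p h

end AdmissiblePair

end DirGraph

end

/-!
The idea of the proof is to map the Leavitt path algebra of the porcupine graph into `L_K(E)` by
letting a vertex `x ∈ H` act as itself, a vertex `x ∈ S` as `x^H`, and, for a path `p` in
`F₁ ∪ F₂` with the idempotent `c` belonging to its end, letting `w^p` act as `p c p*` and `f^p` as
`e (q c q*)` if `p = e q`. No path in `F₁ ∪ F₂` extends another one in a way that `c` does not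
annihilate (`cap_mul_edge_of_spine`), so that the elements `p c p*` are orthogonal idempotents and
the defining relations hold (`isLeavittFamily`). The image is a left ideal, because the product of a
generator of `L_K(E)` with the image of a vertex is zero or again the image of a generator
(`mul_mem_range`); being closed under the involution it is a two-sided ideal, and it contains the
generators of `I(H,S)`.

Injectivity and the statement about all graded ideals both rest on the fact that a graded ideal `I`
equals `I(H,S)`, where `H` is the set of vertices in `I` and `S` the set of breaking vertices `x`
with `x^H ∈ I` (`ideal_pairOfIdeal`). Since a homogeneous element of positive degree is a finite sum
`∑ e (e* x)`, only degree zero has to be considered. There one argues by induction on the length of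
paths: up to elements `e (e* x f) f*`, covered by the induction hypothesis, a homogeneous element
`x ∈ I` of degree zero is a combination of elements `v - ∑ e e* ∈ I` with finite sums over edges
emitted by `v`, and `vert_sub_edgeProj_mem` shows that these lie in `I(H,S)`. If `I` contains no
vertex, then `H = ∅`, no vertex is breaking, and `I = 0`. This applies to the kernel of the above
homomorphism, because the vertices of `L_K(E)` are nonzero (`vert_ne_zero`), which is seen in a
representation on functions on a branching system.

The grading is handled through the representation `gradedRep` of `L_K(E)` on the sequences
`ℤ → L_K(E)`, in which each generator acts by multiplication and a shift by its degree; it shows that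
the components are independent and multiply as they should (`component_eq_homogeneous`).
-/

/-! ### Presentation of the Leavitt path algebra -/

namespace DirGraph

lemma IsRegular.mem_out {E : DirGraph.{u, v}} {x : E.Vert} (hx : E.IsRegular x) {e : E.Edge} :
    e ∈ hx.out ↔ E.src e = x :=
  Set.Finite.mem_toFinset _

end DirGraph

namespace LPA

section Basic

variable {K : Type w} [Field K] {E : DirGraph.{u, v}}

lemma mk_eq_of_rel {x y : FreeLPA K E} (h : FreeLPA.Rel K E x y) : mk K E x = mk K E y :=
  (mk_eq_iff K E x y).2 (.of _ _ ⟨1, x, y, h, (one_smul K x).symm, (one_smul K y).symm⟩)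

lemma vert_mul_vert_of_ne {x y : E.Vert} (h : x ≠ y) : vert K E x * vert K E y = 0 :=
  mk_eq_of_rel (.vert_mul_of_ne x y h)

lemma vert_mul_self (x : E.Vert) : vert K E x * vert K E x = vert K E x :=
  mk_eq_of_rel (.vert_mul_self x)

lemma src_mul_edge (e : E.Edge) : vert K E (E.src e) * edge K E e = edge K E e :=
  mk_eq_of_rel (.src_mul_edge e)

lemma edge_mul_rng (e : E.Edge) : edge K E e * vert K E (E.rng e) = edge K E e :=
  mk_eq_of_rel (.edge_mul_rng e)

lemma rng_mul_ghost (e : E.Edge) : vert K E (E.rng e) * ghost K E e = ghost K E e :=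
  mk_eq_of_rel (.rng_mul_ghost e)

lemma ghost_mul_src (e : E.Edge) : ghost K E e * vert K E (E.src e) = ghost K E e :=
  mk_eq_of_rel (.ghost_mul_src e)

lemma ghost_mul_edge_of_ne {e f : E.Edge} (h : e ≠ f) : ghost K E e * edge K E f = 0 :=
  mk_eq_of_rel (.ghost_mul_edge_of_ne e f h)

lemma ghost_mul_edge_self (e : E.Edge) : ghost K E e * edge K E e = vert K E (E.rng e) :=
  mk_eq_of_rel (.ghost_mul_edge e)

lemma vert_eq_sum {x : E.Vert} (hx : E.IsRegular x) :
    vert K E x = ∑ e ∈ hx.out, edge K E e * ghost K E e := by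
  have h := mk_eq_of_rel (.ck2 (K := K) x hx)
  rw [map_sum] at h
  exact h

lemma vert_mul_edge_of_ne {x : E.Vert} {e : E.Edge} (h : x ≠ E.src e) :
    vert K E x * edge K E e = 0 := by
  rw [← src_mul_edge, ← mul_assoc, vert_mul_vert_of_ne h, zero_mul]

lemma edge_mul_vert_of_ne {x : E.Vert} {e : E.Edge} (h : E.rng e ≠ x) :
    edge K E e * vert K E x = 0 := by
  rw [← edge_mul_rng, mul_assoc, vert_mul_vert_of_ne h, mul_zero]

lemma ghost_mul_vert_of_ne {x : E.Vert} {e : E.Edge} (h : E.src e ≠ x) :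
    ghost K E e * vert K E x = 0 := by
  rw [← ghost_mul_src, mul_assoc, vert_mul_vert_of_ne h, mul_zero]

/-- To prove a property of all elements of `L_K(E)`, it suffices to prove it for the generators and
to show that it is preserved by the algebra operations. -/
@[elab_as_elim]
theorem induction {p : LPA K E → Prop} (vert : ∀ x, p (vert K E x)) (edge : ∀ e, p (edge K E e))
    (ghost : ∀ e, p (ghost K E e)) (zero : p 0) (add : ∀ x y, p x → p y → p (x + y))
    (smul : ∀ (k : K) x, p x → p (k • x)) (mul : ∀ x y, p x → p y → p (x * y)) (x : LPA K E) :
    p x := by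
  obtain ⟨x, rfl⟩ := mk_surjective K E x
  induction x using MonoidAlgebra.induction_linear with
  | zero => rwa [map_zero]
  | add x y hx hy => rw [map_add]; exact add _ _ hx hy
  | single s k =>
    rw [← mul_one k, ← smul_eq_mul, ← MonoidAlgebra.smul_single, mk_smul]
    refine smul _ _ ?_
    have gen : ∀ g : E.Gen, p (mk K E (MonoidAlgebra.single (FreeSemigroup.of g) 1)) := by
      rintro (x | e | e)
      exacts [vert x, edge e, ghost e]
    induction s using FreeSemigroup.recOnMul with
    | ih1 g => exact gen g
    | ih2 g t _ ht =>
      rw [← mul_one (1 : K), ← MonoidAlgebra.single_mul_single, mk_mul]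
      exact mul _ _ (gen g) ht

/-- Elements `V x`, `T e` and `T' e` of a ring, indexed by the vertices and the edges of `E`, which
satisfy the relations imposed on the vertices, the edges and the ghost edges in `L_K(E)`. -/
structure IsLeavittFamily (E : DirGraph.{u, v}) {A : Type*} [NonUnitalRing A] (V : E.Vert → A)
    (T T' : E.Edge → A) : Prop where
  vert_mul_of_ne : ∀ x y, x ≠ y → V x * V y = 0
  vert_mul_self : ∀ x, V x * V x = V x
  src_mul_edge : ∀ e, V (E.src e) * T e = T e
  edge_mul_rng : ∀ e, T e * V (E.rng e) = T e
  rng_mul_ghost : ∀ e, V (E.rng e) * T' e = T' e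
  ghost_mul_src : ∀ e, T' e * V (E.src e) = T' e
  ghost_mul_edge_of_ne : ∀ e f, e ≠ f → T' e * T f = 0
  ghost_mul_edge : ∀ e, T' e * T e = V (E.rng e)
  ck2 : ∀ x (hx : E.IsRegular x), V x = ∑ e ∈ hx.out, T e * T' e

section Lift

variable {A : Type*} [NonUnitalRing A] [Module K A] [IsScalarTower K A A] [SMulCommClass K A A]

/-- The values of a family indexed by vertices, edges and ghost edges at the generators. -/
def genMap (V : E.Vert → A) (T T' : E.Edge → A) : E.Gen → A
  | .vert x => V x
  | .edge e => T e
  | .ghost e => T' e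

variable (K) in
/-- The algebra homomorphism from the free algebra determined by the values at the generators. -/
noncomputable def freeLift (V : E.Vert → A) (T T' : E.Edge → A) : FreeLPA K E →ₙₐ[K] A :=
  MonoidAlgebra.liftMagma K (FreeSemigroup.lift (genMap V T T'))

lemma freeLift_single (V : E.Vert → A) (T T' : E.Edge → A) (g : E.Gen) :
    freeLift K V T T' (MonoidAlgebra.single (FreeSemigroup.of g) 1) = genMap V T T' g := by
  simp [freeLift, MonoidAlgebra.liftMagma_apply_apply]

lemma freeLift_eq_of_con {V : E.Vert → A} {T T' : E.Edge → A} (h : IsLeavittFamily E V T T')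
    {x y : FreeLPA K E} (hxy : FreeLPA.con K E x y) :
    freeLift K V T T' x = freeLift K V T T' y := by
  change RingConGen.Rel _ _ _ at hxy
  induction hxy with
  | of x y hxy =>
    obtain ⟨k, x, y, hr, rfl, rfl⟩ := hxy
    rw [map_smul, map_smul]
    congr 1
    have hv : ∀ x, freeLift K V T T' (FreeLPA.vert K E x) = V x := fun x => freeLift_single ..
    have he : ∀ e, freeLift K V T T' (FreeLPA.edge K E e) = T e := fun e => freeLift_single ..
    have hg : ∀ e, freeLift K V T T' (FreeLPA.ghost K E e) = T' e := fun e => freeLift_single ..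
    cases hr with
    | vert_mul_of_ne x y hne => simpa only [map_mul, hv, map_zero] using h.vert_mul_of_ne x y hne
    | vert_mul_self x => simpa only [map_mul, hv] using h.vert_mul_self x
    | src_mul_edge e => simpa only [map_mul, hv, he] using h.src_mul_edge e
    | edge_mul_rng e => simpa only [map_mul, hv, he] using h.edge_mul_rng e
    | rng_mul_ghost e => simpa only [map_mul, hv, hg] using h.rng_mul_ghost e
    | ghost_mul_src e => simpa only [map_mul, hv, hg] using h.ghost_mul_src e
    | ghost_mul_edge_of_ne e f hne =>
      simpa only [map_mul, he, hg, map_zero] using h.ghost_mul_edge_of_ne e f hne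
    | ghost_mul_edge e => simpa only [map_mul, hv, he, hg] using h.ghost_mul_edge e
    | ck2 x hx => simpa only [map_sum, map_mul, hv, he, hg] using h.ck2 x hx
  | refl x => rfl
  | symm _ ih => exact ih.symm
  | trans _ _ ih₁ ih₂ => exact ih₁.trans ih₂
  | add _ _ ih₁ ih₂ => rw [map_add, map_add, ih₁, ih₂]
  | mul _ _ ih₁ ih₂ => rw [map_mul, map_mul, ih₁, ih₂]

variable (K) in
/-- The universal property of `L_K(E)`. -/
noncomputable def lift {V : E.Vert → A} {T T' : E.Edge → A} (h : IsLeavittFamily E V T T') :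
    LPA K E →ₙₐ[K] A where
  toFun := Quotient.lift (freeLift K V T T') fun _ _ hxy => freeLift_eq_of_con h hxy
  map_smul' k x := by
    obtain ⟨x, rfl⟩ := mk_surjective K E x
    exact map_smul (freeLift K V T T') k x
  map_zero' := map_zero (freeLift K V T T')
  map_add' x y := by
    obtain ⟨x, rfl⟩ := mk_surjective K E x
    obtain ⟨y, rfl⟩ := mk_surjective K E y
    exact map_add (freeLift K V T T') x y
  map_mul' x y := by
    obtain ⟨x, rfl⟩ := mk_surjective K E x
    obtain ⟨y, rfl⟩ := mk_surjective K E y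
    exact map_mul (freeLift K V T T') x y

variable {V : E.Vert → A} {T T' : E.Edge → A} (h : IsLeavittFamily E V T T')

lemma lift_vert (x : E.Vert) : lift K h (vert K E x) = V x := freeLift_single ..

lemma lift_edge (e : E.Edge) : lift K h (edge K E e) = T e := freeLift_single ..

lemma lift_ghost (e : E.Edge) : lift K h (ghost K E e) = T' e := freeLift_single ..

end Lift

/-! ### Local units -/

lemma sum_vert_mul_vert {W : Finset E.Vert} {x : E.Vert} (hx : x ∈ W) :
    (∑ y ∈ W, vert K E y) * vert K E x = vert K E x := by
  rw [Finset.sum_mul, Finset.sum_eq_single_of_mem x hx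
    fun y _ hy => vert_mul_vert_of_ne hy, vert_mul_self]

lemma vert_mul_sum_vert {W : Finset E.Vert} {x : E.Vert} (hx : x ∈ W) :
    vert K E x * (∑ y ∈ W, vert K E y) = vert K E x := by
  rw [Finset.mul_sum, Finset.sum_eq_single_of_mem x hx
    fun y _ hy => vert_mul_vert_of_ne hy.symm, vert_mul_self]

/-- The sums of finitely many vertices are local units of `L_K(E)`. -/
theorem exists_local_unit (x : LPA K E) : ∃ W₀ : Finset E.Vert, ∀ W, W₀ ⊆ W →
    (∑ y ∈ W, vert K E y) * x = x ∧ x * (∑ y ∈ W, vert K E y) = x := by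
  classical
  induction x using LPA.induction with
  | vert x =>
    refine ⟨{x}, fun W hW => ?_⟩
    rw [Finset.singleton_subset_iff] at hW
    exact ⟨sum_vert_mul_vert hW, vert_mul_sum_vert hW⟩
  | edge e =>
    refine ⟨{E.src e, E.rng e}, fun W hW => ?_⟩
    rw [Finset.insert_subset_iff, Finset.singleton_subset_iff] at hW
    constructor
    · rw [← src_mul_edge, ← mul_assoc, sum_vert_mul_vert hW.1]
    · rw [← edge_mul_rng, mul_assoc, vert_mul_sum_vert hW.2]
  | ghost e =>
    refine ⟨{E.src e, E.rng e}, fun W hW => ?_⟩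
    rw [Finset.insert_subset_iff, Finset.singleton_subset_iff] at hW
    constructor
    · rw [← rng_mul_ghost, ← mul_assoc, sum_vert_mul_vert hW.2]
    · rw [← ghost_mul_src, mul_assoc, vert_mul_sum_vert hW.1]
  | zero => exact ⟨∅, fun W _ => ⟨mul_zero _, zero_mul _⟩⟩
  | add x y hx hy =>
    obtain ⟨W₁, h₁⟩ := hx
    obtain ⟨W₂, h₂⟩ := hy
    refine ⟨W₁ ∪ W₂, fun W hW => ?_⟩
    obtain ⟨h₁, h₁'⟩ := h₁ W (Finset.union_subset_left hW)
    obtain ⟨h₂, h₂'⟩ := h₂ W (Finset.union_subset_right hW)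
    rw [mul_add, add_mul, h₁, h₁', h₂, h₂']
    exact ⟨rfl, rfl⟩
  | smul k x hx =>
    obtain ⟨W₀, h⟩ := hx
    refine ⟨W₀, fun W hW => ?_⟩
    obtain ⟨h, h'⟩ := h W hW
    rw [mul_smul_comm, smul_mul_assoc, h, h']
    exact ⟨rfl, rfl⟩
  | mul x y hx hy =>
    obtain ⟨W₁, h₁⟩ := hx
    obtain ⟨W₂, h₂⟩ := hy
    refine ⟨W₁ ∪ W₂, fun W hW => ?_⟩
    rw [← mul_assoc, (h₁ W (Finset.union_subset_left hW)).1, mul_assoc,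
      (h₂ W (Finset.union_subset_right hW)).2]
    exact ⟨rfl, rfl⟩

lemma eq_of_forall_mul_eq {x y : LPA K E} (h : ∀ a, x * a = y * a) : x = y := by
  classical
  obtain ⟨W₁, h₁⟩ := exists_local_unit x
  obtain ⟨W₂, h₂⟩ := exists_local_unit y
  rw [← (h₁ (W₁ ∪ W₂) Finset.subset_union_left).2, ← (h₂ (W₁ ∪ W₂) Finset.subset_union_right).2]
  exact h _

/-- A two-sided ideal of `L_K(E)` is closed under scalars, although ideals of rings without unit
need not be: a local unit `u` of `x` gives `k x = (k u) x`. -/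
lemma ideal_smul_mem (I : TwoSidedIdeal (LPA K E)) (k : K) {x : LPA K E} (hx : x ∈ I) :
    k • x ∈ I := by
  obtain ⟨W, h⟩ := exists_local_unit x
  rw [← (h W subset_rfl).1, ← smul_mul_assoc]
  exact I.mul_mem_left _ _ hx

end Basic

section Star

variable {K : Type w} [Field K] [StarRing K] {E : DirGraph.{u, v}}

lemma star_vert (x : E.Vert) : star (vert K E x) = vert K E x :=
  congrArg (mk K E) (FreeLPA.inv_vert K E x)

lemma star_edge (e : E.Edge) : star (edge K E e) = ghost K E e :=
  congrArg (mk K E) (FreeLPA.inv_edge K E e)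

lemma star_ghost (e : E.Edge) : star (ghost K E e) = edge K E e :=
  congrArg (mk K E) (FreeLPA.inv_ghost K E e)

end Star

end LPA

/-! ### Vertices are nonzero -/

namespace DirGraph

/-- There is an infinite set `X` such that the copies `{x} × X` of `X` at the vertices `x` can be
decomposed as in a branching system: the edges `e` emitted by `x` give injections `σ e` of `X` into
`X` with disjoint images, which cover `X` unless `x` is a sink. -/
lemma exists_branching (E : DirGraph.{u, v}) : ∃ (X : Type v) (_ : Nonempty X)
    (σ : E.Edge → X → X),
    (∀ e f y y', E.src e = E.src f → σ e y = σ f y' → e = f ∧ y = y') ∧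
      ∀ e y, ∃ f y', E.src f = E.src e ∧ σ f y' = y := by
  have key : ∀ e : E.Edge,
      Nonempty ({f // E.src f = E.src e} × (E.Edge ⊕ ℕ) ≃ (E.Edge ⊕ ℕ)) := by
    intro e
    rw [← Cardinal.eq, ← Cardinal.mul_def]
    refine Cardinal.mul_eq_right (Cardinal.aleph0_le_mk _) ?_ ?_
    · exact Cardinal.mk_le_of_injective (f := fun f => Sum.inl f.1)
        fun a b h => Subtype.ext (Sum.inl_injective h)
    · rw [Cardinal.mk_ne_zero_iff]
      exact ⟨⟨e, rfl⟩⟩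
  have key' : ∀ x : E.Vert, ∃ α : {f // E.src f = x} × (E.Edge ⊕ ℕ) → (E.Edge ⊕ ℕ),
      (∃ e, E.src e = x) → Function.Bijective α := by
    intro x
    by_cases hx : ∃ e, E.src e = x
    · obtain ⟨e, rfl⟩ := hx
      obtain ⟨α⟩ := key e
      exact ⟨α, fun _ => α.bijective⟩
    · exact ⟨fun z => z.2, fun h => absurd h hx⟩
  choose α hα using key'
  have transport : ∀ x f (hf : E.src f = x) y, α x (⟨f, hf⟩, y) = α (E.src f) (⟨f, rfl⟩, y) := by
    rintro _ f rfl y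
    rfl
  refine ⟨E.Edge ⊕ ℕ, inferInstance, fun e y => α (E.src e) (⟨e, rfl⟩, y), ?_, ?_⟩
  · intro e f y y' hs h
    have := (hα _ ⟨e, rfl⟩).1 (h.trans (transport _ f hs.symm y').symm)
    simpa only [Prod.mk.injEq, Subtype.mk.injEq] using this
  · intro e y
    obtain ⟨⟨⟨f, hf⟩, y'⟩, h⟩ := (hα (E.src e) ⟨e, rfl⟩).2 y
    exact ⟨f, y', hf, (transport _ f hf y').symm.trans h⟩

end DirGraph

namespace LPA

variable (K : Type w) [Field K] (E : DirGraph.{u, v})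

/-- The vertices of `L_K(E)` are nonzero. The proof lets `L_K(E)` act on the functions on
`E^0 × X` for a branching system on that set: an edge `e` shifts functions along the bijection of
`{r(e)} × X` with the part of `{s(e)} × X` that belongs to `e`. -/
theorem vert_ne_zero (x : E.Vert) : vert K E x ≠ 0 := by
  classical
  obtain ⟨X, ⟨y₀⟩, σ, hinj, hsurj⟩ := E.exists_branching
  let i : E.Vert → X → E.Vert × X := fun x y => (x, y)
  let j : E.Edge → X → E.Vert × X := fun e y => (E.src e, σ e y)
  have hi : ∀ x, Function.Injective (i x) := fun x a b h => (Prod.ext_iff.1 h).2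
  have hj : ∀ e, Function.Injective (j e) := fun e a b h =>
    (hinj e e a b rfl (Prod.ext_iff.1 h).2).2
  let V : E.Vert → Module.End K (E.Vert × X → K) := fun x =>
    { toFun := fun g z => if z.1 = x then g z else 0
      map_add' := fun g h => by ext z; by_cases hz : z.1 = x <;> simp [hz]
      map_smul' := fun g h => by ext z; by_cases hz : z.1 = x <;> simp [hz] }
  let T : E.Edge → Module.End K (E.Vert × X → K) := fun e =>
    Function.ExtendByZero.linearMap K (j e) ∘ₗ LinearMap.funLeft K K (i (E.rng e))
  let T' : E.Edge → Module.End K (E.Vert × X → K) := fun e =>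
    Function.ExtendByZero.linearMap K (i (E.rng e)) ∘ₗ LinearMap.funLeft K K (j e)
  have hV : ∀ x g z, V x g z = if z.1 = x then g z else 0 := fun _ _ _ => rfl
  have hT : ∀ e g y, T e g (j e y) = g (i (E.rng e) y) := fun e g y =>
    (hj e).extend_apply _ _ _
  have hT0 : ∀ e g z, (¬ ∃ y, j e y = z) → T e g z = 0 := fun e g z hz =>
    Function.extend_apply' _ _ _ hz
  have hT' : ∀ e g y, T' e g (i (E.rng e) y) = g (j e y) := fun e g y =>
    (hi _).extend_apply _ _ _
  have hT'0 : ∀ e g (z : E.Vert × X), z.1 ≠ E.rng e → T' e g z = 0 := fun e g z hz =>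
    Function.extend_apply' _ _ _ (by rintro ⟨y, rfl⟩; exact hz rfl)
  have hfam : IsLeavittFamily E V T T' := by
    constructor
    · intro x y hxy
      ext g z
      simp only [Module.End.mul_apply, hV]
      split_ifs with h₁ h₂
      · exact absurd (h₁.symm.trans h₂) hxy
      · rfl
      · rfl
    · intro x
      ext g z
      simp only [Module.End.mul_apply, hV]
      split_ifs <;> rfl
    · intro e
      ext g z
      simp only [Module.End.mul_apply, hV]
      split_ifs with h
      · rfl
      · exact (hT0 e g z (by rintro ⟨y, rfl⟩; exact h rfl)).symm
    · intro e
      ext g z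
      simp only [Module.End.mul_apply]
      by_cases hz : ∃ y, j e y = z
      · obtain ⟨y, rfl⟩ := hz
        rw [hT, hT, hV, if_pos rfl]
      · rw [hT0 _ _ _ hz, hT0 _ _ _ hz]
    · intro e
      ext g z
      simp only [Module.End.mul_apply, hV]
      split_ifs with h
      · rfl
      · exact (hT'0 e g z h).symm
    · intro e
      ext g z
      simp only [Module.End.mul_apply]
      by_cases hz : z.1 = E.rng e
      · obtain ⟨x, y⟩ := z
        obtain rfl : x = E.rng e := hz
        exact (hT' e _ y).trans ((if_pos rfl).trans (hT' e g y).symm)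
      · rw [hT'0 _ _ _ hz, hT'0 _ _ _ hz]
    · intro e f hef
      ext g z
      simp only [Module.End.mul_apply]
      by_cases hz : z.1 = E.rng e
      · obtain ⟨x, y⟩ := z
        obtain rfl : x = E.rng e := hz
        refine (hT' e _ y).trans (hT0 f g _ ?_)
        rintro ⟨y', h⟩
        exact hef (hinj f e y' y (Prod.ext_iff.1 h).1 (Prod.ext_iff.1 h).2).1.symm
      · exact hT'0 _ _ _ hz
    · intro e
      ext g z
      simp only [Module.End.mul_apply, hV]
      split_ifs with hz
      · obtain ⟨x, y⟩ := z
        obtain rfl : x = E.rng e := hz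
        exact (hT' e _ y).trans (hT e g y)
      · exact hT'0 _ _ _ hz
    · intro x hx
      ext g z
      simp only [LinearMap.sum_apply, Finset.sum_apply, Module.End.mul_apply, hV]
      split_ifs with hz
      · obtain ⟨x', y⟩ := z
        obtain rfl : x' = x := hz
        obtain ⟨e, he⟩ := Set.nonempty_iff_ne_empty.2 hx.1
        obtain rfl : E.src e = x' := he
        obtain ⟨f, y', hf, rfl⟩ := hsurj e y
        have hz : (E.src e, σ f y') = j f y' := Prod.ext hf.symm rfl
        rw [Finset.sum_eq_single_of_mem f (hx.mem_out.2 hf), hz]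
        · exact ((hT f _ y').trans (hT' f g y')).symm
        · intro f' hf' hne
          refine hT0 f' _ _ ?_
          rintro ⟨y'', h⟩
          rw [hx.mem_out] at hf'
          exact hne (hinj f' f y'' y' (hf'.trans hf.symm) (Prod.ext_iff.1 h).2).1
      · refine (Finset.sum_eq_zero fun e he => hT0 e _ z ?_).symm
        rintro ⟨y, rfl⟩
        exact hz (hx.mem_out.1 he)
  intro h
  have h0 := congrArg (lift K hfam) h
  rw [lift_vert, map_zero] at h0
  have h1 := congrFun (LinearMap.congr_fun h0 fun _ => 1) (x, y₀)
  rw [hV, if_pos rfl] at h1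
  exact one_ne_zero h1

end LPA

/-! ### Paths as elements of the Leavitt path algebra -/

namespace LPA

section Paths

variable {K : Type w} [Field K] {E : DirGraph.{u, v}}

lemma src_mul_pathElt (p : E.Path) : vert K E p.src * pathElt K E p = pathElt K E p := by
  rcases p with x | ⟨e, l, h⟩
  · exact vert_mul_self x
  · cases l with
    | nil => exact src_mul_edge e
    | cons f l =>
      change vert K E (E.src e) * (edge K E e * _) = edge K E e * _
      rw [← mul_assoc, src_mul_edge]

lemma ghostElt_mul_src (p : E.Path) : ghostElt K E p * vert K E p.src = ghostElt K E p := by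
  rcases p with x | ⟨e, l, h⟩
  · exact vert_mul_self x
  · cases l with
    | nil => exact ghost_mul_src e
    | cons f l =>
      change (_ * ghost K E e) * vert K E (E.src e) = _ * ghost K E e
      rw [mul_assoc, ghost_mul_src]

lemma rng_mul_ghostElt (p : E.Path) : vert K E p.rng * ghostElt K E p = ghostElt K E p := by
  rcases p with x | ⟨e, l, h⟩
  · exact vert_mul_self x
  · change vert K E (E.rng ((e :: l).getLast (List.cons_ne_nil e l))) * ghostsElt K E e l =
      ghostsElt K E e l
    clear h
    induction l generalizing e with
    | nil => exact rng_mul_ghost e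
    | cons f l ih =>
      have h := ih f
      simp only [ghostsElt, List.getLast_cons_cons, ← mul_assoc] at h ⊢
      rw [h]

lemma exists_pathElt_cons (e : E.Edge) (p : E.Path) (h : E.rng e = p.src) :
    ∃ q : E.Path, q.length = p.length + 1 ∧ pathElt K E q = edge K E e * pathElt K E p := by
  rcases p with x | ⟨f, l, hl⟩
  · obtain rfl : E.rng e = x := h
    exact ⟨.edges e [] (List.isChain_singleton e), rfl, (edge_mul_rng e).symm⟩
  · exact ⟨.edges e (f :: l) (List.isChain_cons_cons.2 ⟨h, hl⟩), rfl, rfl⟩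

lemma ghostsElt_append (e f : E.Edge) (l : List E.Edge) :
    ghostsElt K E e (l ++ [f]) = ghost K E f * ghostsElt K E e l := by
  induction l generalizing e with
  | nil => rfl
  | cons a l ih =>
    rw [List.cons_append, ghostsElt, ih, ghostsElt, mul_assoc]

lemma exists_ghostElt_concat (e : E.Edge) (p : E.Path) (h : p.rng = E.src e) :
    ∃ q : E.Path, q.length = p.length + 1 ∧ ghostElt K E q = ghost K E e * ghostElt K E p := by
  rcases p with x | ⟨f, l, hl⟩
  · obtain rfl : x = E.src e := h
    exact ⟨.edges e [] (List.isChain_singleton e), rfl, (ghost_mul_src e).symm⟩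
  · refine ⟨.edges f (l ++ [e]) ?_, by simp [DirGraph.Path.length], ghostsElt_append f e l⟩
    rw [← List.cons_append, List.isChain_append]
    refine ⟨hl, List.isChain_singleton e, fun a ha b hb => ?_⟩
    rw [List.getLast?_eq_some_getLast (List.cons_ne_nil f l), Option.mem_some_iff] at ha
    rw [List.head?_singleton, Option.mem_some_iff] at hb
    subst ha hb
    exact h

lemma ghost_mul_pathElt (e : E.Edge) (p : E.Path) (hp : 0 < p.length) :
    ghost K E e * pathElt K E p = 0 ∨
      ∃ q : E.Path, p.length = q.length + 1 ∧ ghost K E e * pathElt K E p = pathElt K E q := by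
  rcases p with x | ⟨f, l, hl⟩
  · exact absurd hp (lt_irrefl 0)
  by_cases h : e = f
  · subst h
    right
    cases l with
    | nil => exact ⟨.vert (E.rng e), rfl, ghost_mul_edge_self e⟩
    | cons a l =>
      refine ⟨.edges a l hl.tail, rfl, ?_⟩
      change ghost K E e * (edge K E e * _) = _
      rw [← mul_assoc, ghost_mul_edge_self, (List.isChain_cons_cons.1 hl).1]
      exact src_mul_pathElt (.edges a l hl.tail)
  · left
    cases l with
    | nil => exact ghost_mul_edge_of_ne h
    | cons a l =>
      change ghost K E e * (edge K E f * _) = _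
      rw [← mul_assoc, ghost_mul_edge_of_ne h, zero_mul]

lemma ghostElt_mul_edge (e : E.Edge) (p : E.Path) (hp : 0 < p.length) :
    ghostElt K E p * edge K E e = 0 ∨
      ∃ q : E.Path, p.length = q.length + 1 ∧ ghostElt K E p * edge K E e = ghostElt K E q := by
  rcases p with x | ⟨f, l, hl⟩
  · exact absurd hp (lt_irrefl 0)
  by_cases h : f = e
  · subst h
    right
    cases l with
    | nil => exact ⟨.vert (E.rng f), rfl, ghost_mul_edge_self f⟩
    | cons a l =>
      refine ⟨.edges a l hl.tail, rfl, ?_⟩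
      change (_ * ghost K E f) * edge K E f = _
      rw [mul_assoc, ghost_mul_edge_self, (List.isChain_cons_cons.1 hl).1]
      exact ghostElt_mul_src (.edges a l hl.tail)
  · left
    cases l with
    | nil => exact ghost_mul_edge_of_ne h
    | cons a l =>
      change (_ * ghost K E f) * edge K E e = _
      rw [mul_assoc, ghost_mul_edge_of_ne h, mul_zero]

/-- The elements `p q*` span `L_K(E)`. -/
theorem span_pathElt_mul_ghostElt :
    Submodule.span K {x : LPA K E | ∃ p q : E.Path, x = pathElt K E p * ghostElt K E q} = ⊤ := by
  set M := Submodule.span K {x : LPA K E | ∃ p q : E.Path, x = pathElt K E p * ghostElt K E q}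
    with hM
  have mem : ∀ p q : E.Path, pathElt K E p * ghostElt K E q ∈ M := fun p q =>
    Submodule.subset_span ⟨p, q, rfl⟩
  have closed : ∀ a : LPA K E, (∀ p q : E.Path, a * (pathElt K E p * ghostElt K E q) ∈ M) →
      ∀ y ∈ M, a * y ∈ M := by
    intro a ha y hy
    induction hy using Submodule.span_induction with
    | mem y hy =>
      obtain ⟨p, q, rfl⟩ := hy
      exact ha p q
    | zero => rw [mul_zero]; exact zero_mem M
    | add y z _ _ hy hz => rw [mul_add]; exact add_mem hy hz
    | smul k y _ hy => rw [mul_smul_comm]; exact M.smul_mem k hy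
  have left : ∀ x : LPA K E, ∀ y ∈ M, x * y ∈ M := by
    intro x
    induction x using LPA.induction with
    | vert x =>
      refine closed _ fun p q => ?_
      rw [← mul_assoc, ← src_mul_pathElt p, ← mul_assoc]
      by_cases h : x = p.src
      · rw [h, vert_mul_self, src_mul_pathElt]
        exact mem p q
      · rw [vert_mul_vert_of_ne h, zero_mul, zero_mul]
        exact zero_mem M
    | edge e =>
      refine closed _ fun p q => ?_
      by_cases h : E.rng e = p.src
      · obtain ⟨p', -, hp'⟩ := exists_pathElt_cons (K := K) e p h
        rw [← mul_assoc, ← hp']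
        exact mem p' q
      · rw [← mul_assoc, ← src_mul_pathElt p, ← mul_assoc, edge_mul_vert_of_ne h, zero_mul,
          zero_mul]
        exact zero_mem M
    | ghost e =>
      refine closed _ fun p q => ?_
      rw [← mul_assoc]
      rcases Nat.eq_zero_or_pos p.length with hp | hp
      · rcases p with x | ⟨f, l, hl⟩
        · change ghost K E e * vert K E x * _ ∈ M
          by_cases hx : E.src e = x
          · subst hx
            rw [ghost_mul_src]
            by_cases hq : q.rng = E.src e
            · obtain ⟨q', -, hq'⟩ := exists_ghostElt_concat (K := K) e q hq
              rw [← hq', ← rng_mul_ghostElt]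
              exact mem (.vert q'.rng) q'
            · rw [← rng_mul_ghostElt, ← mul_assoc, ghost_mul_vert_of_ne (Ne.symm hq), zero_mul]
              exact zero_mem M
          · rw [ghost_mul_vert_of_ne hx, zero_mul]
            exact zero_mem M
        · exact absurd hp (Nat.succ_ne_zero _)
      · rcases ghost_mul_pathElt (K := K) e p hp with h | ⟨p', -, h⟩
        · rw [h, zero_mul]
          exact zero_mem M
        · rw [h]
          exact mem p' q
    | zero => intro y _; rw [zero_mul]; exact zero_mem M
    | add x x' hx hx' => intro y hy; rw [add_mul]; exact add_mem (hx y hy) (hx' y hy)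
    | smul k x hx => intro y hy; rw [smul_mul_assoc]; exact M.smul_mem k (hx y hy)
    | mul x x' hx hx' => intro y hy; rw [mul_assoc]; exact hx _ (hx' y hy)
  refine eq_top_iff.2 fun x _ => ?_
  obtain ⟨W, h⟩ := exists_local_unit x
  rw [← (h W subset_rfl).2]
  refine left x _ (sum_mem fun y _ => ?_)
  rw [← vert_mul_self]
  exact mem (.vert y) (.vert y)

end Paths

/-! ### The grading -/

section Grading

variable (K : Type w) [Field K] (E : DirGraph.{u, v})

/-- Left multiplication by `a`, followed by a shift of the degree by `n`, on the sequences
`ℤ → L_K(E)`. -/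
noncomputable def shiftMul (a : LPA K E) (n : ℤ) : Module.End K (ℤ → LPA K E) where
  toFun g m := a * g (m - n)
  map_add' g h := by ext m; exact mul_add _ _ _
  map_smul' k g := by ext m; exact mul_smul_comm k a _

variable {K E}

lemma shiftMul_apply (a : LPA K E) (n : ℤ) (g : ℤ → LPA K E) (m : ℤ) :
    shiftMul K E a n g m = a * g (m - n) := rfl

lemma shiftMul_mul (a b : LPA K E) (n m : ℤ) :
    shiftMul K E a n * shiftMul K E b m = shiftMul K E (a * b) (n + m) := by
  ext g i
  simp only [Module.End.mul_apply, shiftMul_apply, mul_assoc, sub_sub]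

variable (K E) in
lemma isLeavittFamily_shiftMul : IsLeavittFamily E (fun x => shiftMul K E (vert K E x) 0)
    (fun e => shiftMul K E (edge K E e) 1) (fun e => shiftMul K E (ghost K E e) (-1)) where
  vert_mul_of_ne x y h := by
    rw [shiftMul_mul, vert_mul_vert_of_ne h]; ext; simp [shiftMul_apply]
  vert_mul_self x := by rw [shiftMul_mul, LPA.vert_mul_self, add_zero]
  src_mul_edge e := by rw [shiftMul_mul, LPA.src_mul_edge, zero_add]
  edge_mul_rng e := by rw [shiftMul_mul, LPA.edge_mul_rng, add_zero]
  rng_mul_ghost e := by rw [shiftMul_mul, LPA.rng_mul_ghost, zero_add]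
  ghost_mul_src e := by rw [shiftMul_mul, LPA.ghost_mul_src, add_zero]
  ghost_mul_edge_of_ne e f h := by
    rw [shiftMul_mul, LPA.ghost_mul_edge_of_ne h]; ext; simp [shiftMul_apply]
  ghost_mul_edge e := by rw [shiftMul_mul, ghost_mul_edge_self, neg_add_cancel]
  ck2 x hx := by
    ext g m
    simp only [shiftMul_mul, add_neg_cancel, LinearMap.sum_apply, Finset.sum_apply,
      shiftMul_apply, ← Finset.sum_mul, vert_eq_sum hx]

variable (K E) in
/-- The representation of `L_K(E)` on the sequences `ℤ → L_K(E)` in which a generator acts by left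
multiplication and shifts by its degree. It plays the role of the coaction
`L_K(E) → L_K(E)[t, t⁻¹]` that describes the grading. -/
noncomputable def gradedRep : LPA K E →ₙₐ[K] Module.End K (ℤ → LPA K E) :=
  lift K (isLeavittFamily_shiftMul K E)

variable (K E) in
/-- The elements of degree `n` according to `gradedRep`. That they are the elements of
`component K E n` is shown in `component_eq_homogeneous`. -/
def homogeneous (n : ℤ) : Submodule K (LPA K E) where
  carrier := {x | gradedRep K E x = shiftMul K E x n}
  add_mem' {x y} hx hy := by
    ext g m
    rw [map_add, hx, hy, shiftMul_apply, add_mul]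
    rfl
  zero_mem' := by
    ext g m
    simp [shiftMul_apply]
  smul_mem' k x hx := by
    ext g m
    rw [map_smul, hx, shiftMul_apply, smul_mul_assoc]
    rfl

lemma mem_homogeneous {n : ℤ} {x : LPA K E} :
    x ∈ homogeneous K E n ↔ gradedRep K E x = shiftMul K E x n := Iff.rfl

lemma vert_mem_homogeneous (x : E.Vert) : vert K E x ∈ homogeneous K E 0 := lift_vert _ x

lemma edge_mem_homogeneous (e : E.Edge) : edge K E e ∈ homogeneous K E 1 := lift_edge _ e

lemma ghost_mem_homogeneous (e : E.Edge) : ghost K E e ∈ homogeneous K E (-1) := lift_ghost _ e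

lemma mul_mem_homogeneous {n m : ℤ} {x y : LPA K E} (hx : x ∈ homogeneous K E n)
    (hy : y ∈ homogeneous K E m) : x * y ∈ homogeneous K E (n + m) := by
  rw [mem_homogeneous] at *
  rw [map_mul, hx, hy, shiftMul_mul]

/-- A homomorphism that respects the degrees of the generators respects the grading. -/
lemma map_mem_homogeneous {F : DirGraph} (φ : LPA K F →ₙₐ[K] LPA K E)
    (hv : ∀ x, φ (vert K F x) ∈ homogeneous K E 0) (he : ∀ e, φ (edge K F e) ∈ homogeneous K E 1)
    (hg : ∀ e, φ (ghost K F e) ∈ homogeneous K E (-1)) {n : ℤ} {x : LPA K F}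
    (hx : x ∈ component K F n) : φ x ∈ homogeneous K E n := by
  have hp : ∀ p : F.Path, φ (pathElt K F p) ∈ homogeneous K E p.length := by
    rintro (x | ⟨e, l, h⟩)
    · exact hv x
    · change φ (edgesElt K F e l) ∈ homogeneous K E ((l.length + 1 : ℕ) : ℤ)
      clear h
      induction l generalizing e with
      | nil => exact he e
      | cons f l ih =>
        rw [edgesElt, map_mul, List.length_cons, Nat.cast_succ, add_comm]
        exact mul_mem_homogeneous (he e) (ih f)
  have hq : ∀ q : F.Path, φ (ghostElt K F q) ∈ homogeneous K E (-q.length) := by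
    rintro (x | ⟨e, l, h⟩)
    · exact hv x
    · change φ (ghostsElt K F e l) ∈ homogeneous K E (-((l.length + 1 : ℕ) : ℤ))
      clear h
      induction l generalizing e with
      | nil => exact hg e
      | cons f l ih =>
        rw [ghostsElt, map_mul, List.length_cons, Nat.cast_succ, neg_add]
        exact mul_mem_homogeneous (ih f) (hg e)
  induction hx using Submodule.span_induction with
  | mem x hx =>
    obtain ⟨p, q, rfl, rfl⟩ := hx
    rw [map_mul, sub_eq_add_neg]
    exact mul_mem_homogeneous (hp p) (hq q)
  | zero => rw [map_zero]; exact zero_mem _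
  | add x y _ _ hx hy => rw [map_add]; exact add_mem hx hy
  | smul k x _ hx => rw [map_smul]; exact Submodule.smul_mem _ k hx

/-- Homogeneous elements of different degrees are independent: a finite sum of them which has
degree `n` is its summand of degree `n`. -/
lemma sum_eq_apply_of_mem_homogeneous {s : ℤ →₀ LPA K E} (hs : ∀ i, s i ∈ homogeneous K E i)
    {n : ℤ} (h : (s.sum fun _ x => x) ∈ homogeneous K E n) : (s.sum fun _ x => x) = s n := by
  classical
  refine eq_of_forall_mul_eq fun a => ?_
  -- Apply both sides to the sequence with the value `a` in degree `0`; its image in degree `n`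
  -- only sees the summand of degree `n`.
  have key : gradedRep K E (s.sum fun _ x => x) (Pi.single 0 a) n = s n * a := by
    rw [Finsupp.sum, map_sum, LinearMap.sum_apply, Finset.sum_apply]
    have h' : ∀ i, gradedRep K E (s i) (Pi.single 0 a) n = if i = n then s i * a else 0 := by
      intro i
      rw [mem_homogeneous.1 (hs i), shiftMul_apply]
      split_ifs with hi
      · rw [hi, sub_self, Pi.single_eq_same]
      · rw [Pi.single_eq_of_ne (sub_ne_zero.2 (Ne.symm hi)), mul_zero]
    simp_rw [h', Finset.sum_ite_eq']
    split_ifs with hn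
    · rfl
    · rw [Finsupp.notMem_support_iff.1 hn, zero_mul]
  rw [mem_homogeneous.1 h, shiftMul_apply, sub_self, Pi.single_eq_same] at key
  exact key

lemma component_le_homogeneous (n : ℤ) : component K E n ≤ homogeneous K E n := fun _ hx =>
  map_mem_homogeneous (NonUnitalAlgHom.id K (LPA K E)) vert_mem_homogeneous edge_mem_homogeneous
    ghost_mem_homogeneous hx

/-- Every element is the sum of its homogeneous components. -/
lemma exists_sum_component (x : LPA K E) :
    ∃ s : ℤ →₀ LPA K E, (∀ i, s i ∈ component K E i) ∧ (s.sum fun _ y => y) = x := by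
  rw [← Submodule.mem_iSup_iff_exists_finsupp]
  have hx : x ∈ Submodule.span K
      {x : LPA K E | ∃ p q : E.Path, x = pathElt K E p * ghostElt K E q} :=
    (span_pathElt_mul_ghostElt (K := K) (E := E)).symm ▸ Submodule.mem_top
  refine Submodule.span_le.2 ?_ hx
  rintro _ ⟨p, q, rfl⟩
  exact Submodule.mem_iSup_of_mem ((p.length : ℤ) - q.length)
    (Submodule.subset_span ⟨p, q, rfl, rfl⟩)

theorem component_eq_homogeneous (n : ℤ) : component K E n = homogeneous K E n := by
  refine le_antisymm (component_le_homogeneous n) fun x hx => ?_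
  obtain ⟨s, hs, rfl⟩ := exists_sum_component x
  rw [sum_eq_apply_of_mem_homogeneous (fun i => component_le_homogeneous i (hs i)) hx]
  exact hs n

lemma mul_mem_component {n m : ℤ} {x y : LPA K E} (hx : x ∈ component K E n)
    (hy : y ∈ component K E m) : x * y ∈ component K E (n + m) := by
  rw [component_eq_homogeneous] at *
  exact mul_mem_homogeneous hx hy

/-- The kernel of a degree preserving homomorphism is a graded ideal. -/
theorem isGradedIdeal_ker {F : DirGraph} (φ : LPA K F →ₙₐ[K] LPA K E)
    (hφ : ∀ n, ∀ x ∈ component K F n, φ x ∈ component K E n) :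
    IsGradedIdeal K F (TwoSidedIdeal.ker φ) := by
  intro x hx
  rw [TwoSidedIdeal.mem_ker] at hx
  obtain ⟨s, hs, rfl⟩ := exists_sum_component x
  refine sum_mem fun i _ => AddSubgroup.subset_closure ⟨?_, i, hs i⟩
  rw [TwoSidedIdeal.mem_ker]
  have hsum : ((s.mapRange φ (map_zero φ)).sum fun _ y => y) = 0 := by
    rw [← hx, Finsupp.sum_mapRange_index fun _ => rfl, Finsupp.sum, Finsupp.sum, map_sum]
  have h := sum_eq_apply_of_mem_homogeneous (n := i) (s := s.mapRange φ (map_zero φ))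
    (fun j => component_eq_homogeneous (K := K) (E := E) j ▸ hφ j _ (hs j))
    (hsum ▸ zero_mem _)
  rw [hsum] at h
  exact h.symm

/-- An injective degree preserving homomorphism also reflects the degree. -/
theorem mem_component_of_map_mem {F : DirGraph} (φ : LPA K F →ₙₐ[K] LPA K E)
    (hφ : ∀ n, ∀ x ∈ component K F n, φ x ∈ component K E n) (hinj : Function.Injective φ)
    {n : ℤ} {x : LPA K F} (hx : φ x ∈ component K E n) : x ∈ component K F n := by
  obtain ⟨s, hs, rfl⟩ := exists_sum_component x
  have hsum : ((s.mapRange φ (map_zero φ)).sum fun _ y => y) = φ (s.sum fun _ y => y) := by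
    rw [Finsupp.sum_mapRange_index fun _ => rfl, Finsupp.sum, Finsupp.sum, map_sum]
  have h := sum_eq_apply_of_mem_homogeneous (n := n) (s := s.mapRange φ (map_zero φ))
    (fun j => component_eq_homogeneous (K := K) (E := E) j ▸ hφ j _ (hs j))
    (by rw [hsum, ← component_eq_homogeneous]; exact hx)
  rw [hsum, Finsupp.mapRange_apply] at h
  rw [hinj h]
  exact hs n

end Grading

end LPA

/-! ### Graded ideals come from admissible pairs -/

namespace LPA

variable {K : Type w} [Field K] {E : DirGraph.{u, v}}

variable (K E) in
/-- The idempotent `∑ e e*`, summed over a finite set of edges. -/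
noncomputable def edgeProj (F : Finset E.Edge) : LPA K E := ∑ e ∈ F, edge K E e * ghost K E e

lemma edgeProj_mul_edge {F : Finset E.Edge} {e : E.Edge} (he : e ∈ F) :
    edgeProj K E F * edge K E e = edge K E e := by
  rw [edgeProj, Finset.sum_mul, Finset.sum_eq_single_of_mem e he, mul_assoc, ghost_mul_edge_self,
    edge_mul_rng]
  intro f _ hf
  rw [mul_assoc, ghost_mul_edge_of_ne hf, mul_zero]

lemma ghost_mul_edgeProj {F : Finset E.Edge} {e : E.Edge} (he : e ∈ F) :
    ghost K E e * edgeProj K E F = ghost K E e := by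
  rw [edgeProj, Finset.mul_sum, Finset.sum_eq_single_of_mem e he, ← mul_assoc,
    ghost_mul_edge_self, rng_mul_ghost]
  intro f _ hf
  rw [← mul_assoc, ghost_mul_edge_of_ne hf.symm, zero_mul]

lemma edgeProj_mul_self (F : Finset E.Edge) :
    edgeProj K E F * edgeProj K E F = edgeProj K E F := by
  conv_lhs => rw [edgeProj, Finset.mul_sum]
  exact Finset.sum_congr rfl fun e he => by
    rw [← mul_assoc]; exact congrArg (· * _) (edgeProj_mul_edge he)

lemma edgeProj_mul_edge_of_notMem {F : Finset E.Edge} {e : E.Edge} (he : e ∉ F) :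
    edgeProj K E F * edge K E e = 0 := by
  rw [edgeProj, Finset.sum_mul]
  refine Finset.sum_eq_zero fun f hf => ?_
  rw [mul_assoc, ghost_mul_edge_of_ne (ne_of_mem_of_not_mem hf he), mul_zero]

lemma vert_mul_edgeProj (F : Finset E.Edge) (x : E.Vert)
    [DecidablePred fun e => E.src e = x] :
    vert K E x * edgeProj K E F = edgeProj K E (F.filter fun e => E.src e = x) := by
  rw [edgeProj, edgeProj, Finset.mul_sum, Finset.sum_filter]
  refine Finset.sum_congr rfl fun e _ => ?_
  split_ifs with h
  · rw [← h, ← mul_assoc, src_mul_edge]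
  · rw [← mul_assoc, vert_mul_edge_of_ne (Ne.symm h), zero_mul]

lemma edgeProj_mul_vert (F : Finset E.Edge) (x : E.Vert)
    [DecidablePred fun e => E.src e = x] :
    edgeProj K E F * vert K E x = edgeProj K E (F.filter fun e => E.src e = x) := by
  rw [edgeProj, edgeProj, Finset.sum_mul, Finset.sum_filter]
  refine Finset.sum_congr rfl fun e _ => ?_
  split_ifs with h
  · rw [← h, mul_assoc, ghost_mul_src]
  · rw [mul_assoc, ghost_mul_vert_of_ne h, mul_zero]

lemma gapElt_eq {H : Set E.Vert} {x : E.Vert} (h : (E.escaping H x).Finite) :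
    E.gapElt K H x = vert K E x - edgeProj K E h.toFinset := by
  rw [DirGraph.gapElt, finsum_mem_eq_finite_toFinset_sum _ h]
  rfl

section Pair

variable (P : E.AdmissiblePair)

lemma vert_mem_ideal {x : E.Vert} (hx : x ∈ P.H) : vert K E x ∈ P.ideal K :=
  TwoSidedIdeal.subset_span (Or.inl ⟨x, hx, rfl⟩)

lemma gapElt_mem_ideal {x : E.Vert} (hx : x ∈ P.S) : E.gapElt K P.H x ∈ P.ideal K :=
  TwoSidedIdeal.subset_span (Or.inr ⟨x, hx, rfl⟩)

end Pair

/-- The admissible pair of a two-sided ideal `I`: the vertices in `I`, and the breaking vertices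
`x` with `x^H ∈ I`. -/
noncomputable def pairOfIdeal (I : TwoSidedIdeal (LPA K E)) : E.AdmissiblePair where
  H := {x | vert K E x ∈ I}
  S := {x | x ∈ E.breaking {x | vert K E x ∈ I} ∧ E.gapElt K {x | vert K E x ∈ I} x ∈ I}
  hereditary := by
    have step : ∀ e, vert K E (E.src e) ∈ I → vert K E (E.rng e) ∈ I := by
      intro e he
      rw [← ghost_mul_edge_self, ← src_mul_edge]
      exact I.mul_mem_left _ _ (I.mul_mem_right _ _ he)
    rintro (x | ⟨e, l, h⟩) hp
    · exact hp
    · change vert K E (E.src e) ∈ I at hp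
      change vert K E (E.rng ((e :: l).getLast (List.cons_ne_nil e l))) ∈ I
      induction l generalizing e with
      | nil => exact step e hp
      | cons f l ih =>
        rw [List.getLast_cons_cons]
        exact ih f h.tail ((List.isChain_cons_cons.1 h).1 ▸ step e hp)
  saturated x hx hH := by
    change vert K E x ∈ I
    rw [vert_eq_sum hx]
    refine sum_mem fun e he => ?_
    have he' : vert K E (E.rng e) ∈ I := hH ⟨e, hx.mem_out.1 he, rfl⟩
    rw [← edge_mul_rng, mul_assoc]
    exact I.mul_mem_left _ _ (I.mul_mem_right _ _ he')
  subset_breaking _ hx := hx.1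

lemma ideal_pairOfIdeal_le (I : TwoSidedIdeal (LPA K E)) : (pairOfIdeal I).ideal K ≤ I := by
  refine TwoSidedIdeal.span_le.2 ?_
  rintro _ (⟨x, hx, rfl⟩ | ⟨x, hx, rfl⟩)
  exacts [hx, hx.2]

/-- The elements `x - ∑ e e*` of `I`, for a vertex `x` and a finite set of edges emitted by `x`,
belong to the ideal of the admissible pair of `I`. The edges outside the finite set have their
ranges in `I`, so that finitely many edges escape from `H` and the element differs from `x^H` by
edges with range in `H`. -/
lemma vert_sub_edgeProj_mem {I : TwoSidedIdeal (LPA K E)} {x : E.Vert} {F : Finset E.Edge}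
    (hF : ∀ e ∈ F, E.src e = x) (h : vert K E x - edgeProj K E F ∈ I) :
    vert K E x - edgeProj K E F ∈ (pairOfIdeal I).ideal K := by
  classical
  set P := pairOfIdeal I
  have hsub : E.escaping P.H x ⊆ F := by
    intro e he
    by_contra hne
    obtain ⟨rfl : E.src e = x, he⟩ := he
    refine he ?_
    have h' := I.mul_mem_left (ghost K E e) _ (I.mul_mem_right _ (edge K E e) h)
    rwa [sub_mul, edgeProj_mul_edge_of_notMem hne, sub_zero, src_mul_edge,
      ghost_mul_edge_self] at h'
  have hfin : (E.escaping P.H x).Finite := F.finite_toSet.subset hsub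
  -- Edges from `x` with range in `H` contribute elements of the ideal.
  have htame : ∀ G : Finset E.Edge, (∀ e ∈ G, E.src e = x ∧ e ∉ E.escaping P.H x) →
      edgeProj K E G ∈ P.ideal K := by
    intro G hG
    refine sum_mem fun e he => ?_
    have hr : E.rng e ∈ P.H := by
      by_contra hr
      exact (hG e he).2 ⟨(hG e he).1, hr⟩
    rw [← edge_mul_rng, mul_assoc]
    exact TwoSidedIdeal.mul_mem_left _ _ _ (TwoSidedIdeal.mul_mem_right _ _ _ (vert_mem_ideal P hr))
  have hsplit : ∀ G : Finset E.Edge, hfin.toFinset ⊆ G →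
      E.gapElt K P.H x = vert K E x - edgeProj K E G + edgeProj K E (G \ hfin.toFinset) := by
    intro G hG
    rw [gapElt_eq hfin, edgeProj, edgeProj, edgeProj, ← Finset.sum_sdiff hG]
    abel
  have hF' : edgeProj K E (F \ hfin.toFinset) ∈ P.ideal K := htame _ fun e he => by
    rw [Finset.mem_sdiff, Set.Finite.mem_toFinset] at he
    exact ⟨hF e he.1, he.2⟩
  have hgap := hsplit F (by simpa using hsub)
  have hgapI : E.gapElt K P.H x ∈ I := by
    rw [hgap]
    exact add_mem h (ideal_pairOfIdeal_le I hF')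
  suffices hgapP : E.gapElt K P.H x ∈ P.ideal K by
    rw [← add_sub_cancel_right (vert K E x - edgeProj K E F) (edgeProj K E (F \ hfin.toFinset)),
      ← hgap]
    exact sub_mem hgapP hF'
  by_cases hx : x ∈ P.H
  · rw [gapElt_eq hfin]
    have : vert K E x - edgeProj K E hfin.toFinset =
        vert K E x - vert K E x * edgeProj K E hfin.toFinset := by
      rw [vert_mul_edgeProj, Finset.filter_true_of_mem]
      exact fun e he => ((Set.Finite.mem_toFinset _).1 he).1
    rw [this]
    exact sub_mem (vert_mem_ideal P hx) (TwoSidedIdeal.mul_mem_right _ _ _ (vert_mem_ideal P hx))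
  rcases (E.escaping P.H x).eq_empty_or_nonempty with hemp | hne
  · have : E.gapElt K P.H x = vert K E x := by simp [DirGraph.gapElt, hemp]
    rw [this] at hgapI
    exact absurd hgapI hx
  by_cases hinf : E.IsInfiniteEmitter x
  · exact gapElt_mem_ideal P (x := x) ⟨⟨hx, hinf, hne, hfin⟩, hgapI⟩
  · have hreg : E.IsRegular x :=
      ⟨fun hs => by obtain ⟨e, he⟩ := hne; exact (hs ▸ he.1 : e ∈ (∅ : Set E.Edge)), hinf⟩
    rw [hsplit hreg.out fun e he =>
      hreg.mem_out.2 (hfin.mem_toFinset.1 he).1, vert_eq_sum hreg]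
    change _ - edgeProj K E hreg.out + _ ∈ _
    rw [edgeProj, sub_self, zero_add]
    refine htame _ fun e he => ?_
    rw [Finset.mem_sdiff, Set.Finite.mem_toFinset] at he
    exact ⟨hreg.mem_out.1 he.1, he.2⟩

variable (K E) in
/-- The span of the elements `p q*` with `|p| = |q| ≤ m`. -/
noncomputable def zeroComponent (m : ℕ) : Submodule K (LPA K E) :=
  Submodule.span K {x | ∃ p q : E.Path, p.length = q.length ∧ p.length ≤ m ∧
    x = pathElt K E p * ghostElt K E q}

lemma zeroComponent_mono {m n : ℕ} (h : m ≤ n) : zeroComponent K E m ≤ zeroComponent K E n :=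
  Submodule.span_mono fun _ ⟨p, q, hpq, hp, hx⟩ => ⟨p, q, hpq, hp.trans h, hx⟩

lemma exists_mem_zeroComponent {x : LPA K E} (hx : x ∈ component K E 0) :
    ∃ m, x ∈ zeroComponent K E m := by
  induction hx using Submodule.span_induction with
  | mem x hx =>
    obtain ⟨p, q, h, rfl⟩ := hx
    exact ⟨p.length, Submodule.subset_span ⟨p, q, by omega, le_rfl, rfl⟩⟩
  | zero => exact ⟨0, zero_mem _⟩
  | add x y _ _ hx hy =>
    obtain ⟨m, hm⟩ := hx
    obtain ⟨n, hn⟩ := hy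
    exact ⟨max m n, add_mem (zeroComponent_mono (le_max_left m n) hm)
      (zeroComponent_mono (le_max_right m n) hn)⟩
  | smul k x _ hx =>
    obtain ⟨m, hm⟩ := hx
    exact ⟨m, Submodule.smul_mem _ k hm⟩

lemma vert_mul_vert_mem_zeroComponent (x y : E.Vert) (m : ℕ) :
    vert K E x * vert K E y ∈ zeroComponent K E m :=
  Submodule.subset_span ⟨.vert x, .vert y, rfl, Nat.zero_le m, rfl⟩

lemma vert_mem_zeroComponent (x : E.Vert) (m : ℕ) : vert K E x ∈ zeroComponent K E m :=
  vert_mul_self (K := K) x ▸ vert_mul_vert_mem_zeroComponent x x m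

lemma ghost_mul_mul_edge_mem {m : ℕ} (e f : E.Edge) {x : LPA K E}
    (hx : x ∈ zeroComponent K E (m + 1)) :
    ghost K E e * x * edge K E f ∈ zeroComponent K E m := by
  induction hx using Submodule.span_induction with
  | mem x hx =>
    obtain ⟨p, q, hpq, hp, rfl⟩ := hx
    rcases Nat.eq_zero_or_pos p.length with h0 | hpos
    · rcases p with x | ⟨e', l, hl⟩
      · rcases q with y | ⟨e', l, hl⟩
        · change ghost K E e * (vert K E x * vert K E y) * edge K E f ∈ _
          have key : ghost K E e * vert K E x * edge K E f ∈ zeroComponent K E m := by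
            by_cases hx : E.src e = x
            · subst hx
              rw [ghost_mul_src]
              by_cases hef : e = f
              · subst hef
                rw [ghost_mul_edge_self]
                exact vert_mem_zeroComponent _ m
              · rw [ghost_mul_edge_of_ne hef]
                exact zero_mem _
            · rw [ghost_mul_vert_of_ne hx, zero_mul]
              exact zero_mem _
          by_cases hxy : x = y
          · subst hxy
            rwa [vert_mul_self]
          · rw [vert_mul_vert_of_ne hxy, mul_zero, zero_mul]
            exact zero_mem _
        · exact absurd hpq.symm (Nat.succ_ne_zero _)
      · exact absurd h0 (Nat.succ_ne_zero _)
    · rw [← mul_assoc, mul_assoc (ghost K E e * _)]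
      rcases ghost_mul_pathElt (K := K) e p hpos with h | ⟨p', hp', h⟩
      · rw [h, zero_mul]
        exact zero_mem _
      rcases ghostElt_mul_edge (K := K) f q (hpq ▸ hpos) with h' | ⟨q', hq', h'⟩
      · rw [h', mul_zero]
        exact zero_mem _
      rw [h, h']
      exact Submodule.subset_span ⟨p', q', by omega, by omega, rfl⟩
  | zero => rw [mul_zero, zero_mul]; exact zero_mem _
  | add x y _ _ hx hy => rw [mul_add, add_mul]; exact add_mem hx hy
  | smul k x _ hx => rw [mul_smul_comm, smul_mul_assoc]; exact Submodule.smul_mem _ k hx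

lemma exists_pathElt_eq_edge_mul (p : E.Path) (hp : 0 < p.length) :
    ∃ e y, pathElt K E p = edge K E e * y := by
  rcases p with x | ⟨e, l, hl⟩
  · exact absurd hp (lt_irrefl 0)
  · cases l with
    | nil => exact ⟨e, vert K E (E.rng e), (edge_mul_rng e).symm⟩
    | cons f l => exact ⟨e, edgesElt K E f l, rfl⟩

lemma exists_ghostElt_eq_mul_ghost (p : E.Path) (hp : 0 < p.length) :
    ∃ e y, ghostElt K E p = y * ghost K E e := by
  rcases p with x | ⟨e, l, hl⟩
  · exact absurd hp (lt_irrefl 0)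
  · cases l with
    | nil => exact ⟨e, vert K E (E.rng e), (rng_mul_ghost e).symm⟩
    | cons f l => exact ⟨e, ghostsElt K E f l, rfl⟩

/-- An element of degree zero is a linear combination of vertices, up to a part which is supported
on finitely many edges from both sides. -/
lemma exists_zeroComponent_decomposition {m : ℕ} {x : LPA K E} (hx : x ∈ zeroComponent K E m) :
    ∃ (c : E.Vert →₀ K) (F₀ : Finset E.Edge), (m = 0 → F₀ = ∅) ∧ ∀ F, F₀ ⊆ F →
      edgeProj K E F * (x - Finsupp.linearCombination K (vert K E) c) * edgeProj K E F =
        x - Finsupp.linearCombination K (vert K E) c := by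
  classical
  induction hx using Submodule.span_induction with
  | mem x hx =>
    obtain ⟨p, q, hpq, hm, rfl⟩ := hx
    rcases Nat.eq_zero_or_pos p.length with h0 | hpos
    · rcases p with x | ⟨e, l, hl⟩
      · rcases q with y | ⟨e, l, hl⟩
        · by_cases hxy : x = y
          · subst hxy
            refine ⟨Finsupp.single x 1, ∅, fun _ => rfl, fun F _ => ?_⟩
            have : pathElt K E (.vert x) * ghostElt K E (.vert x) = vert K E x := vert_mul_self x
            rw [this, Finsupp.linearCombination_single, one_smul, sub_self, mul_zero, zero_mul]
          · refine ⟨0, ∅, fun _ => rfl, fun F _ => ?_⟩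
            have : pathElt K E (.vert x) * ghostElt K E (.vert y) = 0 := vert_mul_vert_of_ne hxy
            rw [this, map_zero, sub_zero, mul_zero, zero_mul]
        · exact absurd hpq.symm (Nat.succ_ne_zero _)
      · exact absurd h0 (Nat.succ_ne_zero _)
    · obtain ⟨e, y, h⟩ := exists_pathElt_eq_edge_mul (K := K) p hpos
      obtain ⟨f, z, h'⟩ := exists_ghostElt_eq_mul_ghost (K := K) q (hpq ▸ hpos)
      refine ⟨0, {e, f}, fun _ => by omega, fun F hF => ?_⟩
      rw [Finset.insert_subset_iff, Finset.singleton_subset_iff] at hF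
      rw [map_zero, sub_zero, h, h']
      simp only [mul_assoc]
      rw [ghost_mul_edgeProj hF.2, ← mul_assoc, edgeProj_mul_edge hF.1]
  | zero => exact ⟨0, ∅, fun _ => rfl, fun F _ => by rw [map_zero, sub_zero, mul_zero, zero_mul]⟩
  | add x y _ _ hx hy =>
    obtain ⟨c, F₁, hF₁, h₁⟩ := hx
    obtain ⟨d, F₂, hF₂, h₂⟩ := hy
    refine ⟨c + d, F₁ ∪ F₂, fun h => by rw [hF₁ h, hF₂ h, Finset.union_empty], fun F hF => ?_⟩
    rw [map_add, add_sub_add_comm, mul_add, add_mul, h₁ F (Finset.union_subset_left hF),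
      h₂ F (Finset.union_subset_right hF)]
  | smul k x _ hx =>
    obtain ⟨c, F₀, hF₀, h⟩ := hx
    refine ⟨k • c, F₀, hF₀, fun F hF => ?_⟩
    rw [map_smul, ← smul_sub, mul_smul_comm, smul_mul_assoc, h F hF]

lemma vert_mul_linearCombination (c : E.Vert →₀ K) (x : E.Vert) :
    vert K E x * Finsupp.linearCombination K (vert K E) c = c x • vert K E x := by
  rw [Finsupp.linearCombination_apply, Finsupp.sum, Finset.mul_sum, Finset.sum_eq_single x,
    mul_smul_comm, vert_mul_self]
  · intro z _ hz
    rw [mul_smul_comm, vert_mul_vert_of_ne hz.symm, smul_zero]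
  · intro hx
    rw [Finsupp.notMem_support_iff.1 hx, zero_smul, mul_zero]

lemma edgeProj_mul_mul_edgeProj_mem {J : TwoSidedIdeal (LPA K E)} {x : LPA K E}
    {F G : Finset E.Edge} (h : ∀ e ∈ F, ∀ f ∈ G, ghost K E e * x * edge K E f ∈ J) :
    edgeProj K E F * x * edgeProj K E G ∈ J := by
  rw [edgeProj, edgeProj, Finset.sum_mul, Finset.sum_mul]
  refine sum_mem fun e he => ?_
  rw [Finset.mul_sum]
  refine sum_mem fun f hf => ?_
  have : edge K E e * ghost K E e * x * (edge K E f * ghost K E f) =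
      edge K E e * (ghost K E e * x * edge K E f * ghost K E f) := by
    simp only [mul_assoc]
  rw [this]
  exact J.mul_mem_left _ _ (J.mul_mem_right _ _ (h e he f hf))

/-- The elements of degree zero of an ideal belong to the ideal of its admissible pair, by induction
on the length of the paths involved. -/
lemma mem_ideal_of_mem_zeroComponent {I : TwoSidedIdeal (LPA K E)} {m : ℕ} {x : LPA K E}
    (hxI : x ∈ I) (hx : x ∈ zeroComponent K E m) : x ∈ (pairOfIdeal I).ideal K := by
  classical
  set J := (pairOfIdeal I).ideal K
  induction m using Nat.strong_induction_on generalizing x with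
  | h m ih =>
  obtain ⟨c, F, hF₀, hF⟩ := exists_zeroComponent_decomposition hx
  replace hF := hF F subset_rfl
  set C := Finsupp.linearCombination K (vert K E) c with hC
  have hinner : ∀ e ∈ F, ∀ f ∈ F, ghost K E e * x * edge K E f ∈ J := by
    intro e he f _
    rcases m with _ | m
    · rw [hF₀ rfl] at he
      exact absurd he (Finset.notMem_empty e)
    · exact ih m (Nat.lt_succ_self m) (I.mul_mem_right _ _ (I.mul_mem_left _ _ hxI))
        (ghost_mul_mul_edge_mem e f hx)
  obtain ⟨W, hW⟩ := exists_local_unit x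
  have hx' : x = ∑ y ∈ W, ∑ z ∈ W, vert K E y * x * vert K E z := by
    simp_rw [← Finset.mul_sum, ← Finset.sum_mul, (hW W subset_rfl).1, (hW W subset_rfl).2]
  rw [hx']
  refine sum_mem fun y _ => sum_mem fun z _ => ?_
  set Fy := F.filter fun e => E.src e = y with hFy
  set Fz := F.filter fun e => E.src e = z with hFz
  have hYZ : edgeProj K E Fy * x * edgeProj K E Fz ∈ J :=
    edgeProj_mul_mul_edgeProj_mem fun e he f hf =>
      hinner e (Finset.mem_of_mem_filter e he) f (Finset.mem_of_mem_filter f hf)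
  have hsplit : vert K E y * x * vert K E z =
      edgeProj K E Fy * x * edgeProj K E Fz +
        (vert K E y * C * vert K E z - edgeProj K E Fy * C * edgeProj K E Fz) := by
    have : vert K E y * (x - C) * vert K E z =
        edgeProj K E Fy * (x - C) * edgeProj K E Fz := by
      rw [hFy, hFz, ← vert_mul_edgeProj, ← edgeProj_mul_vert]
      conv_lhs => rw [← hF]
      simp only [mul_assoc]
    simp only [mul_sub, sub_mul] at this
    rw [add_sub_left_comm, ← this]
    abel
  have hdiag : vert K E y * C * vert K E z - edgeProj K E Fy * C * edgeProj K E Fz =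
      if y = z then c y • (vert K E y - edgeProj K E Fy) else 0 := by
    have hFy' : edgeProj K E Fy = edgeProj K E Fy * vert K E y := by
      rw [edgeProj_mul_vert, hFy, Finset.filter_filter]
      simp only [and_self]
    have hCy : edgeProj K E Fy * C = c y • edgeProj K E Fy := by
      rw [hFy', mul_assoc, hC, vert_mul_linearCombination, mul_smul_comm]
    have hFz' : edgeProj K E Fz = vert K E z * edgeProj K E Fz := by
      rw [vert_mul_edgeProj, hFz, Finset.filter_filter]
      simp only [and_self]
    rw [hCy, hC, vert_mul_linearCombination, smul_mul_assoc, smul_mul_assoc, ← smul_sub]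
    split_ifs with hyz
    · rw [hFy, hFz, ← hyz, vert_mul_self, edgeProj_mul_self]
    · rw [hFy', hFz', mul_assoc, ← mul_assoc (vert K E y) (vert K E z), vert_mul_vert_of_ne hyz,
        zero_mul, mul_zero, sub_zero, smul_zero]
  rw [hsplit, hdiag]
  refine add_mem hYZ ?_
  split_ifs with hyz
  · by_cases hcy : c y = 0
    · rw [hcy, zero_smul]
      exact zero_mem _
    refine ideal_smul_mem _ _ (vert_sub_edgeProj_mem (fun e he => (Finset.mem_filter.1 he).2) ?_)
    have hmem : c y • (vert K E y - edgeProj K E Fy) ∈ I := by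
      rw [if_pos hyz] at hdiag
      rw [← hdiag, ← sub_eq_iff_eq_add'.2 hsplit]
      exact sub_mem (I.mul_mem_right _ _ (I.mul_mem_left _ _ hxI)) (ideal_pairOfIdeal_le I hYZ)
    simpa only [smul_smul, inv_mul_cancel₀ hcy, one_smul] using ideal_smul_mem I (c y)⁻¹ hmem
  · exact zero_mem _

/-- An element of positive degree is supported on finitely many edges from the left. -/
lemma exists_edgeProj_mul_eq {n : ℕ} {x : LPA K E} (hx : x ∈ component K E (n + 1)) :
    ∃ F₀ : Finset E.Edge, ∀ F, F₀ ⊆ F → edgeProj K E F * x = x := by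
  classical
  induction hx using Submodule.span_induction with
  | mem x hx =>
    obtain ⟨p, q, h, rfl⟩ := hx
    obtain ⟨e, y, h⟩ := exists_pathElt_eq_edge_mul (K := K) p (by omega)
    refine ⟨{e}, fun F hF => ?_⟩
    rw [h, ← mul_assoc, ← mul_assoc, edgeProj_mul_edge (Finset.singleton_subset_iff.1 hF)]
  | zero => exact ⟨∅, fun F _ => mul_zero _⟩
  | add x y _ _ hx hy =>
    obtain ⟨F₁, h₁⟩ := hx
    obtain ⟨F₂, h₂⟩ := hy
    refine ⟨F₁ ∪ F₂, fun F hF => ?_⟩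
    rw [mul_add, h₁ F (Finset.union_subset_left hF), h₂ F (Finset.union_subset_right hF)]
  | smul k x _ hx =>
    obtain ⟨F₀, h⟩ := hx
    exact ⟨F₀, fun F hF => by rw [mul_smul_comm, h F hF]⟩

/-- An element of negative degree is supported on finitely many edges from the right. -/
lemma exists_mul_edgeProj_eq {n : ℕ} {x : LPA K E} (hx : x ∈ component K E (-(n + 1))) :
    ∃ F₀ : Finset E.Edge, ∀ F, F₀ ⊆ F → x * edgeProj K E F = x := by
  classical
  induction hx using Submodule.span_induction with
  | mem x hx =>
    obtain ⟨p, q, h, rfl⟩ := hx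
    obtain ⟨e, y, h⟩ := exists_ghostElt_eq_mul_ghost (K := K) q (by omega)
    refine ⟨{e}, fun F hF => ?_⟩
    rw [h, mul_assoc, mul_assoc, ghost_mul_edgeProj (Finset.singleton_subset_iff.1 hF)]
  | zero => exact ⟨∅, fun F _ => zero_mul _⟩
  | add x y _ _ hx hy =>
    obtain ⟨F₁, h₁⟩ := hx
    obtain ⟨F₂, h₂⟩ := hy
    refine ⟨F₁ ∪ F₂, fun F hF => ?_⟩
    rw [add_mul, h₁ F (Finset.union_subset_left hF), h₂ F (Finset.union_subset_right hF)]
  | smul k x _ hx =>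
    obtain ⟨F₀, h⟩ := hx
    exact ⟨F₀, fun F hF => by rw [smul_mul_assoc, h F hF]⟩

lemma edge_mem_component (e : E.Edge) : edge K E e ∈ component K E 1 := by
  rw [component_eq_homogeneous]
  exact edge_mem_homogeneous e

lemma ghost_mem_component (e : E.Edge) : ghost K E e ∈ component K E (-1) := by
  rw [component_eq_homogeneous]
  exact ghost_mem_homogeneous e

/-- The homogeneous elements of an ideal belong to the ideal of its admissible pair. An element `x`
of positive degree is a finite sum `∑ e (e* x)`, which reduces the claim to degree zero, and
negative degrees are treated from the other side. -/
lemma mem_ideal_of_mem_component {I : TwoSidedIdeal (LPA K E)} {n : ℤ} {x : LPA K E}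
    (hxI : x ∈ I) (hx : x ∈ component K E n) : x ∈ (pairOfIdeal I).ideal K := by
  have hzero : ∀ x ∈ I, x ∈ component K E 0 → x ∈ (pairOfIdeal I).ideal K := fun x hxI hx =>
    (exists_mem_zeroComponent hx).elim fun _ => mem_ideal_of_mem_zeroComponent hxI
  have hpos : ∀ (n : ℕ), ∀ x ∈ I, x ∈ component K E n → x ∈ (pairOfIdeal I).ideal K := by
    intro n
    induction n with
    | zero => exact hzero
    | succ n ih =>
      intro x hxI hx
      rw [Nat.cast_succ] at hx
      obtain ⟨F, hF⟩ := exists_edgeProj_mul_eq hx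
      rw [← hF F subset_rfl, edgeProj, Finset.sum_mul]
      refine sum_mem fun e _ => ?_
      rw [mul_assoc]
      refine TwoSidedIdeal.mul_mem_left _ _ _ (ih _ (I.mul_mem_left _ _ hxI) ?_)
      have := mul_mem_component (ghost_mem_component e) hx
      rwa [neg_add_cancel_comm_assoc] at this
  have hneg : ∀ (n : ℕ), ∀ x ∈ I, x ∈ component K E (-n) → x ∈ (pairOfIdeal I).ideal K := by
    intro n
    induction n with
    | zero => exact hzero
    | succ n ih =>
      intro x hxI hx
      rw [Nat.cast_succ] at hx
      obtain ⟨F, hF⟩ := exists_mul_edgeProj_eq hx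
      rw [← hF F subset_rfl, edgeProj, Finset.mul_sum]
      refine sum_mem fun e _ => ?_
      rw [← mul_assoc]
      refine TwoSidedIdeal.mul_mem_right _ _ _ (ih _ (I.mul_mem_right _ _ hxI) ?_)
      have := mul_mem_component hx (edge_mem_component e)
      rwa [neg_add, neg_add_cancel_right] at this
  obtain ⟨n, rfl | rfl⟩ := n.eq_nat_or_neg
  exacts [hpos n x hxI hx, hneg n x hxI hx]

/-- Every graded ideal is the ideal `I(H,S)` of an admissible pair. -/
theorem ideal_pairOfIdeal {I : TwoSidedIdeal (LPA K E)} (hI : IsGradedIdeal K E I) :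
    (pairOfIdeal I).ideal K = I := by
  refine le_antisymm (ideal_pairOfIdeal_le I) fun x hx => ?_
  have hcl := hI x hx
  clear hx
  induction hcl using AddSubgroup.closure_induction with
  | mem y hy =>
    obtain ⟨hy, n, hn⟩ := hy
    exact mem_ideal_of_mem_component hy hn
  | zero => exact zero_mem _
  | add y z _ _ hy hz => exact add_mem hy hz
  | neg y _ hy => exact neg_mem hy

/-- The graded uniqueness theorem: a graded ideal which contains no vertex is zero. Its admissible
pair has `H = ∅`, and there are no breaking vertices for the empty set. -/
theorem eq_zero_of_mem_graded {I : TwoSidedIdeal (LPA K E)} (hI : IsGradedIdeal K E I)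
    (hv : ∀ x, vert K E x ∉ I) {x : LPA K E} (hx : x ∈ I) : x = 0 := by
  rw [← ideal_pairOfIdeal hI, DirGraph.AdmissiblePair.ideal, TwoSidedIdeal.mem_span_iff] at hx
  have h := hx ⊥ ?_
  · simpa using h
  rintro _ (⟨y, hy, rfl⟩ | ⟨y, hy, rfl⟩)
  · exact absurd hy (hv y)
  · obtain ⟨-, hinf, -, hfin⟩ := hy.1
    refine absurd (hfin.subset fun e he => ⟨he, fun h => hv _ h⟩) hinf

end LPA

/-! ### The Leavitt family of the porcupine graph -/

namespace DirGraph.AdmissiblePair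

variable {E : DirGraph.{u, v}} (P : E.AdmissiblePair)

lemma notMem_H_of_mem_S {x : E.Vert} (hx : x ∈ P.S) : x ∉ P.H := (P.subset_breaking hx).1

lemma finite_escaping {x : E.Vert} (hx : x ∈ P.S) : (E.escaping P.H x).Finite :=
  (P.subset_breaking hx).2.2.2

lemma rng_mem_H {e : E.Edge} (h : E.src e ∈ P.H) : E.rng e ∈ P.H :=
  P.hereditary (.edges e [] (List.isChain_singleton e)) h

lemma exists_tame_edge {x : E.Vert} (hx : x ∈ P.S) : ∃ e, E.src e = x ∧ E.rng e ∈ P.H := by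
  obtain ⟨-, hinf, -, hfin⟩ := P.subset_breaking hx
  obtain ⟨e, he, he'⟩ := (hinf.sdiff hfin).nonempty
  exact ⟨e, he, by_contra fun h => he' ⟨he, h⟩⟩

/-- The paths in `F₁ ∪ F₂` start outside `H`. -/
lemma src_notMem_H {e : E.Edge} {l : List E.Edge} {hc}
    (h : Path.edges e l hc ∈ P.F₁ ∪ P.F₂) : E.src e ∉ P.H := by
  induction l generalizing e with
  | nil =>
    intro he
    rcases h with h | h
    · exact h.2 (Or.inl he)
    · exact P.notMem_H_of_mem_S h.1 (P.rng_mem_H he)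
  | cons f l ih =>
    intro he
    exact ih (P.tail_mem h) ((List.isChain_cons_cons.1 hc).1 ▸ P.rng_mem_H he)

/-- The first edge of a path in `F₁ ∪ F₂` which starts in `S` escapes from `H`. -/
lemma rng_notMem_H {e : E.Edge} {l : List E.Edge} {hc}
    (h : Path.edges e l hc ∈ P.F₁ ∪ P.F₂) (hs : E.src e ∈ P.S) : E.rng e ∉ P.H := by
  intro hr
  cases l with
  | nil =>
    rcases h with h | h
    · exact h.2 (Or.inr hs)
    · exact P.notMem_H_of_mem_S h.1 hr
  | cons f l => exact P.src_notMem_H (P.tail_mem h) ((List.isChain_cons_cons.1 hc).1 ▸ hr)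

section Elements

variable (K : Type w) [Field K]

open Classical in
/-- The idempotent of `L_K(E)` that corresponds to a vertex `x ∈ H ∪ S` of the porcupine graph:
`x^H` if `x ∈ S`, and `x` otherwise. -/
noncomputable def cap (x : E.Vert) : LPA K E :=
  if x ∈ P.S then E.gapElt K P.H x else LPA.vert K E x

variable {K} in
lemma cap_of_mem {x : E.Vert} (hx : x ∈ P.S) :
    P.cap K x = LPA.vert K E x - LPA.edgeProj K E (P.finite_escaping hx).toFinset := by
  rw [cap, if_pos hx, LPA.gapElt_eq (P.finite_escaping hx)]

variable {K} in
lemma cap_of_mem_H {x : E.Vert} (hx : x ∈ P.H) : P.cap K x = LPA.vert K E x :=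
  if_neg fun h => P.notMem_H_of_mem_S h hx

lemma vert_mul_cap (x : E.Vert) : LPA.vert K E x * P.cap K x = P.cap K x := by
  classical
  by_cases hx : x ∈ P.S
  · rw [P.cap_of_mem hx, mul_sub, LPA.vert_mul_self, LPA.vert_mul_edgeProj,
      Finset.filter_true_of_mem fun e he => ((Set.Finite.mem_toFinset _).1 he).1]
  · rw [cap, if_neg hx, LPA.vert_mul_self]

lemma cap_mul_vert (x : E.Vert) : P.cap K x * LPA.vert K E x = P.cap K x := by
  classical
  by_cases hx : x ∈ P.S
  · rw [P.cap_of_mem hx, sub_mul, LPA.vert_mul_self, LPA.edgeProj_mul_vert,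
      Finset.filter_true_of_mem fun e he => ((Set.Finite.mem_toFinset _).1 he).1]
  · rw [cap, if_neg hx, LPA.vert_mul_self]

lemma cap_mul_edgeProj {x : E.Vert} (hx : x ∈ P.S) :
    P.cap K x * LPA.edgeProj K E (P.finite_escaping hx).toFinset = 0 := by
  classical
  rw [P.cap_of_mem hx, sub_mul, LPA.edgeProj_mul_self, LPA.vert_mul_edgeProj,
    Finset.filter_true_of_mem fun e he => ((Set.Finite.mem_toFinset _).1 he).1, sub_self]

lemma cap_mul_self (x : E.Vert) : P.cap K x * P.cap K x = P.cap K x := by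
  by_cases hx : x ∈ P.S
  · conv_lhs => rw [P.cap_of_mem hx (K := K)]
    rw [← P.cap_of_mem hx]
    conv_lhs => arg 2; rw [P.cap_of_mem hx]
    rw [mul_sub, P.cap_mul_edgeProj K hx, cap_mul_vert, sub_zero]
  · rw [cap, if_neg hx, LPA.vert_mul_self]

lemma cap_mul_cap_of_ne {x y : E.Vert} (h : x ≠ y) : P.cap K x * P.cap K y = 0 := by
  rw [← P.cap_mul_vert K x, mul_assoc, ← P.vert_mul_cap K y, ← mul_assoc (LPA.vert K E x),
    LPA.vert_mul_vert_of_ne h, zero_mul, mul_zero]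

/-- The edges of `E` that belong to the porcupine graph start at their cap. -/
lemma cap_mul_edge {e : E.Edge} (h : E.src e ∈ P.H ∨ (E.src e ∈ P.S ∧ E.rng e ∈ P.H)) :
    P.cap K (E.src e) * LPA.edge K E e = LPA.edge K E e := by
  rcases h with h | ⟨hs, hr⟩
  · rw [P.cap_of_mem_H h, LPA.src_mul_edge]
  · rw [P.cap_of_mem hs, sub_mul, LPA.src_mul_edge, LPA.edgeProj_mul_edge_of_notMem, sub_zero]
    rw [Set.Finite.mem_toFinset]
    exact fun he => he.2 hr

lemma cap_mul_edge_of_ne {x : E.Vert} {e : E.Edge} (h : x ≠ E.src e) :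
    P.cap K x * LPA.edge K E e = 0 := by
  rw [← cap_mul_vert, mul_assoc, LPA.vert_mul_edge_of_ne h, mul_zero]

lemma cap_mul_edge_of_escaping {e : E.Edge} (hs : E.src e ∈ P.S) (hr : E.rng e ∉ P.H) :
    P.cap K (E.src e) * LPA.edge K E e = 0 := by
  rw [P.cap_of_mem hs, sub_mul, LPA.src_mul_edge, LPA.edgeProj_mul_edge, sub_self]
  rw [Set.Finite.mem_toFinset]
  exact ⟨rfl, hr⟩

/-- The caps annihilate the first edges of the paths in `F₁ ∪ F₂`. -/
lemma cap_mul_edge_of_spine {x : E.Vert} (hx : x ∈ P.H ∪ P.S) {e : E.Edge} {l : List E.Edge} {hc}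
    (h : Path.edges e l hc ∈ P.F₁ ∪ P.F₂) : P.cap K x * LPA.edge K E e = 0 := by
  by_cases hxe : x = E.src e
  · subst hxe
    have hs := hx.resolve_left (P.src_notMem_H h)
    exact P.cap_mul_edge_of_escaping K hs (P.rng_notMem_H h hs)
  · exact P.cap_mul_edge_of_ne K hxe

lemma cap_mem_ideal {x : E.Vert} (hx : x ∈ P.H ∪ P.S) : P.cap K x ∈ P.ideal K := by
  by_cases h : x ∈ P.S
  · rw [cap, if_pos h]
    exact LPA.gapElt_mem_ideal P h
  · rw [cap, if_neg h]
    exact LPA.vert_mem_ideal P (hx.resolve_right h)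

lemma cap_mem_homogeneous (x : E.Vert) : P.cap K x ∈ LPA.homogeneous K E 0 := by
  by_cases hx : x ∈ P.S
  · rw [P.cap_of_mem hx]
    exact sub_mem (LPA.vert_mem_homogeneous x) (sum_mem fun e _ =>
      LPA.mul_mem_homogeneous (LPA.edge_mem_homogeneous e) (LPA.ghost_mem_homogeneous e))
  · rw [cap, if_neg hx]
    exact LPA.vert_mem_homogeneous x

lemma cap_ne_zero (x : E.Vert) : P.cap K x ≠ 0 := by
  by_cases hx : x ∈ P.S
  · obtain ⟨e, rfl, he⟩ := P.exists_tame_edge hx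
    intro h
    have h' := P.cap_mul_edge K (Or.inr ⟨hx, he⟩)
    rw [h, zero_mul] at h'
    exact LPA.vert_ne_zero K E (E.rng e) (by rw [← LPA.ghost_mul_edge_self, ← h', mul_zero])
  · rw [cap, if_neg hx]
    exact LPA.vert_ne_zero K E x

/-- For a path `p = e l` with first edge `e`, the idempotent that corresponds to the range of `f^p`
in the porcupine graph: with `c` the cap at the end of `p` it is `c` if `l` is empty and
`l c l*` otherwise. -/
noncomputable def corner (e : E.Edge) : List E.Edge → LPA K E
  | [] => P.cap K (E.rng e)
  | f :: l => LPA.edge K E f * corner f l * LPA.ghost K E f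

lemma corner_cons (e f : E.Edge) (l : List E.Edge) :
    P.corner K e (f :: l) = LPA.edge K E f * P.corner K f l * LPA.ghost K E f := rfl

lemma rng_mul_corner {e : E.Edge} {l : List E.Edge}
    (hc : (e :: l).IsChain fun a b => E.rng a = E.src b) :
    LPA.vert K E (E.rng e) * P.corner K e l = P.corner K e l := by
  cases l with
  | nil => exact P.vert_mul_cap K _
  | cons f l =>
    rw [corner_cons, (List.isChain_cons_cons.1 hc).1, ← mul_assoc, ← mul_assoc, LPA.src_mul_edge]

lemma corner_mul_self {e : E.Edge} {l : List E.Edge}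
    (hc : l.IsChain fun a b => E.rng a = E.src b) :
    P.corner K e l * P.corner K e l = P.corner K e l := by
  induction l generalizing e with
  | nil => exact P.cap_mul_self K _
  | cons f l ih =>
    have : ∀ a b c : LPA K E, a * b * c * (a * b * c) = a * (b * ((c * a) * b)) * c := by
      intro a b c
      simp only [mul_assoc]
    rw [corner_cons, this, LPA.ghost_mul_edge_self, P.rng_mul_corner K hc, ih hc.tail]

lemma corner_mem_ideal {e : E.Edge} {l : List E.Edge} {hc}
    (h : Path.edges e l hc ∈ P.F₁ ∪ P.F₂) : P.corner K e l ∈ P.ideal K := by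
  induction l generalizing e with
  | nil => exact P.cap_mem_ideal K (P.rng_mem_of_edge h)
  | cons f l ih =>
    exact TwoSidedIdeal.mul_mem_right _ _ _ (TwoSidedIdeal.mul_mem_left _ _ _ (ih (P.tail_mem h)))

lemma corner_mem_homogeneous (e : E.Edge) (l : List E.Edge) :
    P.corner K e l ∈ LPA.homogeneous K E 0 := by
  induction l generalizing e with
  | nil => exact P.cap_mem_homogeneous K _
  | cons f l ih =>
    have := LPA.mul_mem_homogeneous (LPA.mul_mem_homogeneous (LPA.edge_mem_homogeneous f) (ih f))
      (LPA.ghost_mem_homogeneous f)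
    rwa [add_zero, add_neg_cancel] at this

lemma corner_ne_zero {e : E.Edge} {l : List E.Edge}
    (hc : l.IsChain fun a b => E.rng a = E.src b) : P.corner K e l ≠ 0 := by
  induction l generalizing e with
  | nil => exact P.cap_ne_zero K _
  | cons f l ih =>
    intro h
    apply ih hc.tail
    have h' : LPA.ghost K E f * P.corner K e (f :: l) * LPA.edge K E f * P.corner K f l =
        P.corner K f l := by
      have : ∀ a b c : LPA K E, a * (b * c * a) * b * c = (a * b) * (c * ((a * b) * c)) := by
        intro a b c
        simp only [mul_assoc]
      rw [corner_cons, this, LPA.ghost_mul_edge_self, P.rng_mul_corner K hc,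
        P.corner_mul_self K (l := l) hc.tail, P.rng_mul_corner K hc]
    rw [← h', h, mul_zero, zero_mul, zero_mul]

/-- The images of the vertices of the porcupine graph in `L_K(E)`: for `p ∈ F₁ ∪ F₂` with cap `c`
at its end, the image of `w^p` is `p c p*`. Paths of length zero do not occur in `F₁ ∪ F₂`; their
value is irrelevant. -/
noncomputable def vertMap : P.porcupine.Vert → LPA K E
  | .body x _ => P.cap K x
  | .spine (.vert _) _ => 0
  | .spine (.edges e l _) _ => LPA.edge K E e * P.corner K e l * LPA.ghost K E e

/-- The images of the edges of the porcupine graph in `L_K(E)`: for `p ∈ F₁ ∪ F₂` with cap `c` at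
its end, the image of `f^p` is `e c` if `p = e` is an edge and `p c q*` if `p = e q`. -/
noncomputable def edgeMap : P.porcupine.Edge → LPA K E
  | .body e _ => LPA.edge K E e
  | .spine (.vert _) _ => 0
  | .spine (.edges e l _) _ => LPA.edge K E e * P.corner K e l

variable {P} in
lemma vert_notMem {x : E.Vert} : Path.vert x ∉ P.F₁ ∪ P.F₂ := fun h =>
  h.elim (fun h => h) fun h => absurd h.2 (lt_irrefl 0)

lemma vertMap_spineRng {e : E.Edge} {l : List E.Edge} {hc}
    (h : Path.edges e l hc ∈ P.F₁ ∪ P.F₂) :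
    P.vertMap K (P.spineRng _ h) = P.corner K e l := by
  cases l <;> rfl

lemma vertMap_ne_zero (z : P.porcupine.Vert) : P.vertMap K z ≠ 0 := by
  rcases z with ⟨x, hx⟩ | ⟨x | ⟨e, l, hc⟩, h⟩
  · exact P.cap_ne_zero K x
  · exact absurd h vert_notMem
  · exact P.corner_ne_zero K (e := e) (l := e :: l) hc

end Elements

section Family

variable (K : Type w) [Field K] [StarRing K]

lemma star_cap (x : E.Vert) : star (P.cap K x) = P.cap K x := by
  by_cases hx : x ∈ P.S
  · rw [P.cap_of_mem hx, star_sub, LPA.star_vert, LPA.edgeProj, star_sum]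
    simp only [star_mul, LPA.star_edge, LPA.star_ghost]
  · rw [cap, if_neg hx, LPA.star_vert]

lemma star_corner (e : E.Edge) (l : List E.Edge) : star (P.corner K e l) = P.corner K e l := by
  induction l generalizing e with
  | nil => exact P.star_cap K _
  | cons f l ih =>
    rw [corner_cons, star_mul, star_mul, ih, LPA.star_edge, LPA.star_ghost, mul_assoc]

lemma corner_mul_corner_of_ne {e : E.Edge} {l l' : List E.Edge} {hc hc'}
    (h : Path.edges e l hc ∈ P.F₁ ∪ P.F₂) (h' : Path.edges e l' hc' ∈ P.F₁ ∪ P.F₂)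
    (hne : l ≠ l') : P.corner K e l * P.corner K e l' = 0 := by
  induction l generalizing e l' with
  | nil =>
    cases l' with
    | nil => exact absurd rfl hne
    | cons f l' =>
      rw [corner_cons, ← mul_assoc, ← mul_assoc]
      rw [corner, P.cap_mul_edge_of_spine K (P.rng_mem_of_edge h) (P.tail_mem h'), zero_mul,
        zero_mul]
  | cons f l ih =>
    cases l' with
    | nil =>
      rw [← star_star (_ * _), star_mul, star_corner, star_corner, corner_cons, ← mul_assoc,
        ← mul_assoc, corner, P.cap_mul_edge_of_spine K (P.rng_mem_of_edge h') (P.tail_mem h),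
        zero_mul, zero_mul, star_zero]
    | cons f' l' =>
      have : ∀ a b c a' b' c' : LPA K E,
          a * b * c * (a' * b' * c') = a * (b * ((c * a') * b')) * c' := by
        intros
        simp only [mul_assoc]
      rw [corner_cons, corner_cons, this]
      by_cases hf : f = f'
      · subst hf
        rw [LPA.ghost_mul_edge_self, P.rng_mul_corner K hc'.tail,
          ih (P.tail_mem h) (P.tail_mem h') fun hl => hne (hl ▸ rfl), mul_zero, zero_mul]
      · rw [LPA.ghost_mul_edge_of_ne hf, zero_mul, mul_zero, mul_zero, zero_mul]

lemma star_vertMap (z : P.porcupine.Vert) : star (P.vertMap K z) = P.vertMap K z := by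
  rcases z with ⟨x, hx⟩ | ⟨x | ⟨e, l, hc⟩, h⟩
  · exact P.star_cap K x
  · exact absurd h vert_notMem
  · exact P.star_corner K e (e :: l)

/-- The edge of `E` underlying an edge of the porcupine graph: `e` itself, or the first edge of `p`
for `f^p`. -/
def baseEdge : P.porcupine.Edge → E.Edge
  | .body e _ => e
  | .spine (.vert _) h => absurd h vert_notMem
  | .spine (.edges e _ _) _ => e

lemma isLeavittFamily :
    LPA.IsLeavittFamily P.porcupine (P.vertMap K) (P.edgeMap K) (fun f => star (P.edgeMap K f)) := by
  have src_mul : ∀ f : P.porcupine.Edge,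
      P.vertMap K (P.porcupine.src f) * P.edgeMap K f = P.edgeMap K f := by
    rintro (⟨e, he⟩ | ⟨x | ⟨e, l, hc⟩, h⟩)
    · exact P.cap_mul_edge K he
    · exact absurd h vert_notMem
    · change LPA.edge K E e * P.corner K e l * LPA.ghost K E e * (LPA.edge K E e * P.corner K e l) =
        LPA.edge K E e * P.corner K e l
      rw [mul_assoc, ← mul_assoc (LPA.ghost K E e), LPA.ghost_mul_edge_self,
        P.rng_mul_corner K hc, mul_assoc, P.corner_mul_self K (l := l) hc.tail]
  have mul_rng : ∀ f : P.porcupine.Edge,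
      P.edgeMap K f * P.vertMap K (P.porcupine.rng f) = P.edgeMap K f := by
    rintro (⟨e, he⟩ | ⟨x | ⟨e, l, hc⟩, h⟩)
    · change LPA.edge K E e * P.cap K (E.rng e) = LPA.edge K E e
      rw [P.cap_of_mem_H (he.elim P.rng_mem_H And.right), LPA.edge_mul_rng]
    · exact absurd h vert_notMem
    · change LPA.edge K E e * P.corner K e l * P.vertMap K (P.spineRng _ h) = _
      rw [vertMap_spineRng, mul_assoc, P.corner_mul_self K (l := l) hc.tail]
      rfl
  have body_spine : ∀ (x : E.Vert) (hx : x ∈ P.H ∪ P.S) (p : E.Path) (h : p ∈ P.F₁ ∪ P.F₂),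
      P.vertMap K (PorcupineVert.body x hx) * P.vertMap K (PorcupineVert.spine p h) = 0 := by
    rintro x hx (y | ⟨e, l, hc⟩) h
    · exact absurd h vert_notMem
    · change P.cap K x * (LPA.edge K E e * P.corner K e l * LPA.ghost K E e) = 0
      rw [← mul_assoc, ← mul_assoc, P.cap_mul_edge_of_spine K hx h, zero_mul, zero_mul]
  have comm : ∀ z w, P.vertMap K z * P.vertMap K w = 0 → P.vertMap K w * P.vertMap K z = 0 := by
    intro z w hzw
    have h := congrArg star hzw
    rwa [star_mul, star_vertMap, star_vertMap, star_zero] at h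
  have body_ne_spine : ∀ (e : E.Edge)
      (_ : E.src e ∈ P.H ∨ (E.src e ∈ P.S ∧ E.rng e ∈ P.H)) (f : E.Edge) (l : List E.Edge) (hc)
      (_ : Path.edges f l hc ∈ P.F₁ ∪ P.F₂), e ≠ f := by
    rintro e he _ l hc h rfl
    rcases he with he | ⟨hs, hr⟩
    exacts [P.src_notMem_H h he, P.rng_notMem_H h hs hr]
  constructor
  · rintro (⟨x, hx⟩ | ⟨p, h⟩) (⟨y, hy⟩ | ⟨q, h'⟩) hne
    · exact P.cap_mul_cap_of_ne K fun hxy => hne (by subst hxy; rfl)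
    · exact body_spine x hx q h'
    · exact comm _ _ (body_spine y hy p h)
    · rcases p with x | ⟨e, l, hc⟩
      · exact absurd h vert_notMem
      rcases q with y | ⟨f, l', hc'⟩
      · exact absurd h' vert_notMem
      have : ∀ a b c a' b' c' : LPA K E,
          a * b * c * (a' * b' * c') = a * (b * ((c * a') * b')) * c' := by
        intros
        simp only [mul_assoc]
      refine (this _ _ _ _ _ _).trans ?_
      by_cases hef : e = f
      · subst hef
        rw [LPA.ghost_mul_edge_self, P.rng_mul_corner K hc', P.corner_mul_corner_of_ne K h h',
          mul_zero, zero_mul]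
        exact fun hl => hne (by subst hl; rfl)
      · rw [LPA.ghost_mul_edge_of_ne hef, zero_mul, mul_zero, mul_zero, zero_mul]
  · rintro (⟨x, hx⟩ | ⟨x | ⟨e, l, hc⟩, h⟩)
    · exact P.cap_mul_self K x
    · exact absurd h vert_notMem
    · exact P.corner_mul_self K (e := e) (l := e :: l) hc
  · exact src_mul
  · exact mul_rng
  · intro f
    have h := congrArg star (mul_rng f)
    rwa [star_mul, star_vertMap] at h
  · intro f
    have h := congrArg star (src_mul f)
    rwa [star_mul, star_vertMap] at h
  · rintro (⟨e, he⟩ | ⟨x | ⟨e, l, hc⟩, h⟩) (⟨f, hf⟩ | ⟨y | ⟨f, l', hc'⟩, h'⟩) hne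
    · change star (LPA.edge K E e) * LPA.edge K E f = 0
      rw [LPA.star_edge, LPA.ghost_mul_edge_of_ne]
      rintro rfl
      exact hne rfl
    · exact absurd h' vert_notMem
    · change star (LPA.edge K E e) * (LPA.edge K E f * P.corner K f l') = 0
      rw [LPA.star_edge, ← mul_assoc,
        LPA.ghost_mul_edge_of_ne (body_ne_spine e he f l' hc' h'), zero_mul]
    · exact absurd h vert_notMem
    · exact absurd h vert_notMem
    · exact absurd h vert_notMem
    · change star (LPA.edge K E e * P.corner K e l) * LPA.edge K E f = 0
      rw [star_mul, LPA.star_edge, mul_assoc,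
        LPA.ghost_mul_edge_of_ne (body_ne_spine f hf e l hc h).symm, mul_zero]
    · exact absurd h' vert_notMem
    · change star (LPA.edge K E e * P.corner K e l) * (LPA.edge K E f * P.corner K f l') = 0
      rw [star_mul, LPA.star_edge, star_corner, mul_assoc, ← mul_assoc (LPA.ghost K E e)]
      by_cases hef : e = f
      · subst hef
        rw [LPA.ghost_mul_edge_self, P.rng_mul_corner K hc', P.corner_mul_corner_of_ne K h h']
        exact fun hl => hne (by subst hl; rfl)
      · rw [LPA.ghost_mul_edge_of_ne hef, zero_mul, mul_zero]
  · rintro (⟨e, he⟩ | ⟨x | ⟨e, l, hc⟩, h⟩)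
    · change star (LPA.edge K E e) * LPA.edge K E e = P.cap K (E.rng e)
      rw [P.cap_of_mem_H (he.elim P.rng_mem_H And.right), LPA.star_edge, LPA.ghost_mul_edge_self]
    · exact absurd h vert_notMem
    · change star (LPA.edge K E e * P.corner K e l) * (LPA.edge K E e * P.corner K e l) =
        P.vertMap K (P.spineRng _ h)
      rw [star_mul, LPA.star_edge, star_corner, mul_assoc, ← mul_assoc (LPA.ghost K E e),
        LPA.ghost_mul_edge_self, P.rng_mul_corner K hc, P.corner_mul_self K (l := l) hc.tail, vertMap_spineRng]
  · rintro (⟨x, hx⟩ | ⟨x | ⟨e, l, hc⟩, h⟩) hreg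
    · have hfin : (P.porcupine.emitted (.body x hx)).Finite := Set.not_infinite.1 hreg.2
      -- The edges emitted by `x` in `E` which belong to the porcupine graph.
      have hsub : {e | E.src e = x ∧ (E.src e ∈ P.H ∨ E.src e ∈ P.S ∧ E.rng e ∈ P.H)} ⊆
          P.baseEdge '' P.porcupine.emitted (.body x hx) := by
        rintro e ⟨rfl, he⟩
        exact ⟨.body e he, rfl, rfl⟩
      have hxH : x ∈ P.H := by
        refine hx.resolve_right fun hs => ?_
        obtain ⟨-, hinf, -, hesc⟩ := P.subset_breaking hs
        refine (hinf.sdiff hesc) ((hfin.image P.baseEdge).subset (subset_trans ?_ hsub))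
        rintro e ⟨rfl, he⟩
        exact ⟨rfl, Or.inr ⟨hs, by_contra fun hr => he ⟨rfl, hr⟩⟩⟩
      have hbody : ∀ f ∈ P.porcupine.emitted (PorcupineVert.body x hx),
          ∃ e he, E.src e = x ∧ f = (PorcupineEdge.body e he : P.PorcupineEdge) := by
        rintro (⟨e, he⟩ | ⟨p, h⟩) hf
        · refine ⟨e, he, ?_, rfl⟩
          change PorcupineVert.body _ _ = PorcupineVert.body x hx at hf
          injection hf
        · change PorcupineVert.spine _ _ = PorcupineVert.body x hx at hf
          injection hf
      have hregE : E.IsRegular x := by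
        constructor
        · intro hsink
          obtain ⟨f, hf⟩ := Set.nonempty_iff_ne_empty.2 hreg.1
          obtain ⟨e, he, hex, -⟩ := hbody f hf
          exact (hsink ▸ hex : e ∈ (∅ : Set E.Edge))
        · refine Set.not_infinite.2 ((hfin.image P.baseEdge).subset (subset_trans ?_ hsub))
          rintro e rfl
          exact ⟨rfl, Or.inl hxH⟩
      change P.cap K x = _
      rw [P.cap_of_mem_H hxH, LPA.vert_eq_sum hregE]
      symm
      refine Finset.sum_nbij P.baseEdge ?_ ?_ ?_ ?_
      · intro f hf
        obtain ⟨e, he, hex, rfl⟩ := hbody f (hreg.mem_out.1 hf)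
        exact hregE.mem_out.2 hex
      · intro f hf f' hf' hff'
        obtain ⟨e, he, hex, rfl⟩ := hbody f (hreg.mem_out.1 hf)
        obtain ⟨e', he', hex', rfl⟩ := hbody f' (hreg.mem_out.1 hf')
        obtain rfl : e = e' := hff'
        rfl
      · intro e he
        obtain rfl := hregE.mem_out.1 he
        exact ⟨PorcupineEdge.body e (Or.inl hxH), hreg.mem_out.2 rfl, rfl⟩
      · intro f hf
        obtain ⟨e, he, hex, rfl⟩ := hbody f (hreg.mem_out.1 hf)
        exact congrArg (LPA.edge K E e * ·) (LPA.star_edge e)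
    · exact absurd h vert_notMem
    · refine Eq.trans ?_ (Finset.sum_eq_single_of_mem
        (PorcupineEdge.spine (.edges e l hc) h : P.porcupine.Edge) (hreg.mem_out.2 rfl) ?_).symm
      · change LPA.edge K E e * P.corner K e l * LPA.ghost K E e =
          LPA.edge K E e * P.corner K e l * star (LPA.edge K E e * P.corner K e l)
        rw [star_mul, LPA.star_edge, star_corner, ← mul_assoc, mul_assoc (LPA.edge K E e) _
          (P.corner K e l), P.corner_mul_self K (l := l) hc.tail]
      · rintro (⟨f, hf⟩ | ⟨q, h'⟩) hmem hne
        · have hsrc := hreg.mem_out.1 hmem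
          change PorcupineVert.body _ _ = PorcupineVert.spine _ _ at hsrc
          injection hsrc
        · have hsrc := hreg.mem_out.1 hmem
          change PorcupineVert.spine _ _ = PorcupineVert.spine _ _ at hsrc
          injection hsrc with hq
          exact absurd (by subst hq; rfl) hne

end Family

end DirGraph.AdmissiblePair

/-! ### The isomorphism of `L_K(P_(H,S))` with the ideal `I(H,S)` -/

namespace DirGraph.AdmissiblePair

variable {E : DirGraph.{u, v}} (P : E.AdmissiblePair) (K : Type w) [Field K] [StarRing K]

/-- The `*`-homomorphism from the Leavitt path algebra of the porcupine graph to `L_K(E)`. -/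
noncomputable def porcupineHom : LPA K P.porcupine →⋆ₙₐ[K] LPA K E where
  toNonUnitalAlgHom := LPA.lift K (P.isLeavittFamily K)
  map_star' x := by
    change LPA.lift K (P.isLeavittFamily K) (star x) = star (LPA.lift K (P.isLeavittFamily K) x)
    induction x using LPA.induction with
    | vert z => rw [LPA.star_vert, LPA.lift_vert, star_vertMap]
    | edge f => rw [LPA.star_edge, LPA.lift_ghost, LPA.lift_edge]
    | ghost f => rw [LPA.star_ghost, LPA.lift_ghost, LPA.lift_edge, star_star]
    | zero => rw [star_zero, map_zero, star_zero]
    | add x y hx hy => rw [star_add, map_add, map_add, star_add, hx, hy]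
    | smul k x hx => rw [star_smul, map_smul, map_smul, star_smul, hx]
    | mul x y hx hy => rw [star_mul, map_mul, map_mul, star_mul, hx, hy]

lemma porcupineHom_vert (z : P.porcupine.Vert) :
    P.porcupineHom K (LPA.vert K _ z) = P.vertMap K z := LPA.lift_vert (P.isLeavittFamily K) z

lemma porcupineHom_edge (f : P.porcupine.Edge) :
    P.porcupineHom K (LPA.edge K _ f) = P.edgeMap K f := LPA.lift_edge (P.isLeavittFamily K) f

lemma porcupineHom_ghost (f : P.porcupine.Edge) :
    P.porcupineHom K (LPA.ghost K _ f) = star (P.edgeMap K f) := LPA.lift_ghost (P.isLeavittFamily K) f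

lemma porcupineHom_mem_component (n : ℤ) (x : LPA K P.porcupine)
    (hx : x ∈ LPA.component K P.porcupine n) : P.porcupineHom K x ∈ LPA.component K E n := by
  rw [LPA.component_eq_homogeneous]
  refine LPA.map_mem_homogeneous (P.porcupineHom K).toNonUnitalAlgHom ?_ ?_ ?_ hx
  · intro z
    refine (P.porcupineHom_vert K z).symm ▸ ?_
    rcases z with ⟨x, hx⟩ | ⟨x | ⟨e, l, hc⟩, h⟩
    · exact P.cap_mem_homogeneous K x
    · exact absurd h vert_notMem
    · exact P.corner_mem_homogeneous K e (e :: l)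
  · intro f
    refine (P.porcupineHom_edge K f).symm ▸ ?_
    rcases f with ⟨e, he⟩ | ⟨x | ⟨e, l, hc⟩, h⟩
    · exact LPA.edge_mem_homogeneous e
    · exact absurd h vert_notMem
    · exact LPA.mul_mem_homogeneous (LPA.edge_mem_homogeneous e) (P.corner_mem_homogeneous K e l)
  · intro f
    refine (P.porcupineHom_ghost K f).symm ▸ ?_
    rcases f with ⟨e, he⟩ | ⟨x | ⟨e, l, hc⟩, h⟩
    · exact (LPA.star_edge (K := K) e).symm ▸ LPA.ghost_mem_homogeneous e
    · exact absurd h vert_notMem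
    · change star (LPA.edge K E e * P.corner K e l) ∈ _
      rw [star_mul, star_corner, LPA.star_edge]
      exact LPA.mul_mem_homogeneous (P.corner_mem_homogeneous K e l) (LPA.ghost_mem_homogeneous e)

/-- Injectivity is an instance of the graded uniqueness theorem: the kernel is graded and contains
no vertex. -/
lemma porcupineHom_injective : Function.Injective (P.porcupineHom K) := by
  refine (injective_iff_map_eq_zero (P.porcupineHom K)).2 fun x hx => ?_
  refine LPA.eq_zero_of_mem_graded (LPA.isGradedIdeal_ker (P.porcupineHom K).toNonUnitalAlgHom
    (P.porcupineHom_mem_component K)) (fun z hz => ?_) ((TwoSidedIdeal.mem_ker _).2 hx)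
  exact P.vertMap_ne_zero K z
    ((P.porcupineHom_vert K z).symm.trans ((TwoSidedIdeal.mem_ker _).1 hz))

lemma porcupineHom_mem_ideal (x : LPA K P.porcupine) : P.porcupineHom K x ∈ P.ideal K := by
  have hv : ∀ z, P.porcupineHom K (LPA.vert K _ z) ∈ P.ideal K := by
    intro z
    rw [porcupineHom_vert]
    rcases z with ⟨x, hx⟩ | ⟨x | ⟨e, l, hc⟩, h⟩
    · exact P.cap_mem_ideal K hx
    · exact absurd h vert_notMem
    · exact TwoSidedIdeal.mul_mem_right _ _ _
        (TwoSidedIdeal.mul_mem_left _ _ _ (P.corner_mem_ideal K h))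
  induction x using LPA.induction with
  | vert z => exact hv z
  | edge f =>
    rw [← LPA.src_mul_edge, map_mul]
    exact TwoSidedIdeal.mul_mem_right _ _ _ (hv _)
  | ghost f =>
    rw [← LPA.rng_mul_ghost, map_mul]
    exact TwoSidedIdeal.mul_mem_right _ _ _ (hv _)
  | zero => rw [map_zero]; exact zero_mem _
  | add x y hx hy => rw [map_add]; exact add_mem hx hy
  | smul k x hx => rw [map_smul]; exact LPA.ideal_smul_mem _ k hx
  | mul x y hx _ => rw [map_mul]; exact TwoSidedIdeal.mul_mem_right _ _ _ hx

lemma vert_mul_vertMap_mem (x : E.Vert) (z : P.porcupine.Vert) :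
    LPA.vert K E x * P.vertMap K z ∈ Set.range (P.porcupineHom K) := by
  obtain ⟨y, hy⟩ : ∃ y, LPA.vert K E y * P.vertMap K z = P.vertMap K z := by
    rcases z with ⟨x, hx⟩ | ⟨x | ⟨e, l, hc⟩, h⟩
    · exact ⟨x, P.vert_mul_cap K x⟩
    · exact absurd h vert_notMem
    · refine ⟨E.src e, ?_⟩
      change LPA.vert K E _ * (LPA.edge K E e * P.corner K e l * LPA.ghost K E e) =
        LPA.edge K E e * P.corner K e l * LPA.ghost K E e
      rw [← mul_assoc, ← mul_assoc, LPA.src_mul_edge]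
  rw [← hy, ← mul_assoc]
  by_cases hxy : x = y
  · subst hxy
    rw [LPA.vert_mul_self, hy]
    exact ⟨_, P.porcupineHom_vert K z⟩
  · rw [LPA.vert_mul_vert_of_ne hxy, zero_mul]
    exact ⟨0, map_zero _⟩

lemma edge_mul_vertMap_mem (e : E.Edge) (z : P.porcupine.Vert) :
    LPA.edge K E e * P.vertMap K z ∈ Set.range (P.porcupineHom K) := by
  rcases z with ⟨x, hx⟩ | ⟨x | ⟨f, l, hc⟩, h⟩
  · change LPA.edge K E e * P.cap K x ∈ _
    by_cases hex : E.rng e = x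
    · subst hex
      by_cases he : E.src e ∈ P.H ∨ (E.src e ∈ P.S ∧ E.rng e ∈ P.H)
      · rw [P.cap_of_mem_H (he.elim P.rng_mem_H And.right), LPA.edge_mul_rng]
        exact ⟨_, P.porcupineHom_edge K (PorcupineEdge.body e he)⟩
      · have h : Path.edges e [] (List.isChain_singleton e) ∈ P.F₁ ∪ P.F₂ := by
          rcases hx with hx | hx
          · refine Or.inl ⟨hx, fun hs => he ?_⟩
            exact hs.imp id fun hs => ⟨hs, hx⟩
          · exact Or.inr ⟨hx, Nat.succ_pos _⟩
        exact ⟨_, P.porcupineHom_edge K (PorcupineEdge.spine _ h)⟩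
    · rw [← vert_mul_cap, ← mul_assoc, LPA.edge_mul_vert_of_ne hex, zero_mul]
      exact ⟨0, map_zero _⟩
  · exact absurd h vert_notMem
  · change LPA.edge K E e * P.corner K f (f :: l) ∈ _
    by_cases hef : E.rng e = E.src f
    · have h' : Path.edges e (f :: l) (List.isChain_cons_cons.2 ⟨hef, hc⟩) ∈ P.F₁ ∪ P.F₂ :=
        h.imp (fun h => h) fun h => ⟨h.1, Nat.succ_pos _⟩
      exact ⟨_, P.porcupineHom_edge K (PorcupineEdge.spine _ h')⟩
    · rw [corner_cons, ← mul_assoc, ← mul_assoc, ← LPA.src_mul_edge f, ← mul_assoc,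
        LPA.edge_mul_vert_of_ne hef, zero_mul, zero_mul, zero_mul]
      exact ⟨0, map_zero _⟩

lemma ghost_mul_vertMap_mem (e : E.Edge) (z : P.porcupine.Vert) :
    LPA.ghost K E e * P.vertMap K z ∈ Set.range (P.porcupineHom K) := by
  rcases z with ⟨x, hx⟩ | ⟨x | ⟨f, l, hc⟩, h⟩
  · change LPA.ghost K E e * P.cap K x ∈ _
    have hstar : LPA.ghost K E e * P.cap K x = star (P.cap K x * LPA.edge K E e) := by
      rw [star_mul, star_cap, LPA.star_edge]
    rw [hstar]
    by_cases hex : x = E.src e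
    · subst hex
      by_cases he : E.src e ∈ P.H ∨ (E.src e ∈ P.S ∧ E.rng e ∈ P.H)
      · rw [P.cap_mul_edge K he]
        exact ⟨_, P.porcupineHom_ghost K (PorcupineEdge.body e he)⟩
      · have hs : E.src e ∈ P.S := hx.resolve_left fun h => he (Or.inl h)
        rw [P.cap_mul_edge_of_escaping K hs fun hr => he (Or.inr ⟨hs, hr⟩), star_zero]
        exact ⟨0, map_zero _⟩
    · rw [P.cap_mul_edge_of_ne K hex, star_zero]
      exact ⟨0, map_zero _⟩
  · exact absurd h vert_notMem
  · change LPA.ghost K E e * (LPA.edge K E f * P.corner K f l * LPA.ghost K E f) ∈ _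
    rw [← mul_assoc, ← mul_assoc]
    by_cases hef : e = f
    · subst hef
      rw [LPA.ghost_mul_edge_self, P.rng_mul_corner K hc]
      refine ⟨_, (P.porcupineHom_ghost K (PorcupineEdge.spine _ h)).trans ?_⟩
      change star (LPA.edge K E e * P.corner K e l) = _
      rw [star_mul, star_corner, LPA.star_edge]
    · rw [LPA.ghost_mul_edge_of_ne hef, zero_mul, zero_mul]
      exact ⟨0, map_zero _⟩

/-- The image of the Leavitt path algebra of the porcupine graph is a left ideal. As the edges and
ghost edges of the porcupine graph are multiples of vertices, it suffices to multiply the images of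
the vertices with the generators of `L_K(E)`. -/
lemma mul_mem_range (a : LPA K E) (x : LPA K P.porcupine) :
    a * P.porcupineHom K x ∈ Set.range (P.porcupineHom K) := by
  have mul_mem : ∀ y ∈ Set.range (P.porcupineHom K), ∀ x : LPA K P.porcupine,
      y * P.porcupineHom K x ∈ Set.range (P.porcupineHom K) := by
    rintro _ ⟨y, rfl⟩ x
    exact ⟨y * x, map_mul _ _ _⟩
  have add_mem : ∀ y ∈ Set.range (P.porcupineHom K), ∀ y' ∈ Set.range (P.porcupineHom K),
      y + y' ∈ Set.range (P.porcupineHom K) := by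
    rintro _ ⟨y, rfl⟩ _ ⟨y', rfl⟩
    exact ⟨y + y', map_add _ _ _⟩
  have smul_mem : ∀ (k : K), ∀ y ∈ Set.range (P.porcupineHom K),
      k • y ∈ Set.range (P.porcupineHom K) := by
    rintro k _ ⟨y, rfl⟩
    exact ⟨k • y, map_smul _ _ _⟩
  have reduce : ∀ a : LPA K E,
      (∀ z, a * P.vertMap K z ∈ Set.range (P.porcupineHom K)) →
        ∀ x, a * P.porcupineHom K x ∈ Set.range (P.porcupineHom K) := by
    intro a ha x
    have hv : ∀ z, a * P.porcupineHom K (LPA.vert K _ z) ∈ Set.range (P.porcupineHom K) :=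
      fun z => (P.porcupineHom_vert K z).symm ▸ ha z
    induction x using LPA.induction with
    | vert z => exact hv z
    | edge f =>
      rw [← LPA.src_mul_edge, map_mul, ← mul_assoc]
      exact mul_mem _ (hv _) _
    | ghost f =>
      rw [← LPA.rng_mul_ghost, map_mul, ← mul_assoc]
      exact mul_mem _ (hv _) _
    | zero => exact ⟨0, by rw [map_zero, mul_zero]⟩
    | add x y hx hy => rw [map_add, mul_add]; exact add_mem _ hx _ hy
    | smul k x hx => rw [map_smul, mul_smul_comm]; exact smul_mem k _ hx
    | mul x y hx _ => rw [map_mul, ← mul_assoc]; exact mul_mem _ hx _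
  induction a using LPA.induction generalizing x with
  | vert y => exact reduce _ (P.vert_mul_vertMap_mem K y) x
  | edge e => exact reduce _ (P.edge_mul_vertMap_mem K e) x
  | ghost e => exact reduce _ (P.ghost_mul_vertMap_mem K e) x
  | zero => exact ⟨0, by rw [map_zero, zero_mul]⟩
  | add a b ha hb => rw [add_mul]; exact add_mem _ (ha x) _ (hb x)
  | smul k a ha => rw [smul_mul_assoc]; exact smul_mem k _ (ha x)
  | mul a b ha hb =>
    obtain ⟨y, hy⟩ := hb x
    rw [mul_assoc, ← hy]
    exact ha y

lemma range_porcupineHom : Set.range (P.porcupineHom K) = (P.ideal K : Set (LPA K E)) := by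
  refine Set.Subset.antisymm (Set.range_subset_iff.2 (P.porcupineHom_mem_ideal K)) ?_
  let J : TwoSidedIdeal (LPA K E) := TwoSidedIdeal.mk' (Set.range (P.porcupineHom K))
    ⟨0, map_zero _⟩
    (by rintro _ _ ⟨x, rfl⟩ ⟨y, rfl⟩; exact ⟨x + y, map_add _ _ _⟩)
    (by rintro _ ⟨x, rfl⟩; exact ⟨-x, map_neg _ _⟩)
    (by rintro a _ ⟨x, rfl⟩; exact P.mul_mem_range K a x)
    (by
      rintro _ a ⟨x, rfl⟩
      obtain ⟨y, hy⟩ := P.mul_mem_range K (star a) (star x)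
      refine ⟨star y, ?_⟩
      rw [map_star, hy, map_star, star_mul, star_star, star_star])
  have hJ : (J : Set (LPA K E)) = Set.range (P.porcupineHom K) := TwoSidedIdeal.coe_mk' ..
  rw [← hJ]
  refine TwoSidedIdeal.span_le.2 ?_
  rw [hJ]
  rintro _ (⟨x, hx, rfl⟩ | ⟨x, hx, rfl⟩)
  · exact ⟨_, (P.porcupineHom_vert K (PorcupineVert.body x (Or.inl hx))).trans
      (P.cap_of_mem_H hx)⟩
  · exact ⟨_, (P.porcupineHom_vert K (PorcupineVert.body x (Or.inr hx))).trans (if_pos hx)⟩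

theorem isGradedStarIsoIdeal : LPA.IsGradedStarIsoIdeal K E P.porcupine (P.ideal K) :=
  ⟨P.porcupineHom K, P.porcupineHom_injective K, P.range_porcupineHom K, fun n x =>
    ⟨P.porcupineHom_mem_component K n x,
      LPA.mem_component_of_map_mem (P.porcupineHom K).toNonUnitalAlgHom
        (P.porcupineHom_mem_component K) (P.porcupineHom_injective K)⟩⟩

end DirGraph.AdmissiblePair

theorem theorem3p2 {K : Type w} [Field K] [StarRing K] (E : DirGraph.{u, v}) :
    (∀ P : E.AdmissiblePair, LPA.IsGradedStarIsoIdeal K E P.porcupine (P.ideal K)) ∧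
      ∀ I : TwoSidedIdeal (LPA K E), LPA.IsGradedIdeal K E I →
        ∃ F : DirGraph.{max u v, max u v}, LPA.IsGradedStarIsoIdeal K E F I :=
  ⟨fun P => P.isGradedStarIsoIdeal K, fun I hI => ⟨(LPA.pairOfIdeal I).porcupine, by
    have h := (LPA.pairOfIdeal I).isGradedStarIsoIdeal K
    rwa [LPA.ideal_pairOfIdeal hI] at h⟩⟩
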